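/- \textbf{Setting.} Fix an integer $k\ge 1$ and a real number $V>0$. For each positive integer $\ell$ let $\mathcal A(\ell)$ be the space of weight $k$ holomorphic cusp forms on $\Gamma_0(\ell)$, with the Petersson inner product $$\langle f,g\rangle_\ell=\int_{\Gamma_0(\ell)\backslash\mathbb H}\overline{f(z)}\,g(z)\,y^k\,d\mu_\ell(z),$$ where $\mu_\ell$ is the multiple of $dx\,dy/y^2$ for which $\Gamma_0(\ell)\backslash\mathbb H$ has volume $V$. For $d\ge1$ put $\varphi|_d(z)=d^{k/2}\varphi(dz)$. The newspace $\mathcal A^*(q)$ is the orthogonal complement in $\mathcal A(q)$ of the span of all $\varphi|_d$ with $\ell\mid q$, $\ell\ne q$, $d\mid q/\ell$ and $\varphi\in\mathcal A(\ell)$. For $n\ge1$ let $$T_n\varphi(z)=n^{k-1}\sum_{ad=n}d^{-k}\sum_{b=0}^{d-1}\varphi\Bigl(\frac{az+b}{d}\Bigr).$$ \textbf{Statement.} Let $q\ge1$ be an integer divisible by the cube of every prime dividing it, and let $n\ge1$ be an integer coprime to $q$. Let $\Psi:\Gamma_0(q)\backslash\mathbb H\to\mathbb C$ be measurable and of moderate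 growth, i.e. there are real $C,A$ with $|\Psi(\gamma z)|\le C\,(\operatorname{Im} z)^A$ for all $\gamma\in \mathrm{SL}_2(\mathbb Z)$ and all $z$ in the standard fundamental domain $\{|z|\ge1,\ |\operatorname{Re}z|\le\tfrac12\}$ of $\mathrm{SL}_2(\mathbb Z)$. Let $\mathcal B^*(q)$ be any orthonormal basis of $\mathcal A^*(q)$ for $\langle\cdot,\cdot\rangle_q$, and for each $\ell\mid q$ let $\mathcal B(\ell)$ be any orthonormal basis of $\mathcal A(\ell)$ for $\langle\cdot,\cdot\rangle_\ell$. Then $$\sum_{\varphi\in\mathcal B^*(q)}\langle\varphi,\Psi\cdot T_n\varphi\rangle_q=\sum_{d,e\mid q}\mu(d)\mu(e)\sum_{\varphi\in\mathcal B(q/(de))}\bigl\langle\varphi|_d,\ \Psi\cdot T_n(\varphi|_d)\bigr\rangle_q ,$$ where $\mu$ is the M\"obius function, all the integrals occurring converge absolutely, and the terms with $\mu(d)\mu(e)=0$ are understood to be $0$ (for all others $de\mid q$). -/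

import Mathlib

open UpperHalfPlane MeasureTheory
open scoped MatrixGroups ModularForm Modular Pointwise

noncomputable section

namespace NewformIsolation

/-- The space `A(ℓ)` of holomorphic cusp forms of weight `k` on `Γ₀(ℓ)`, as a space of functions
on the upper half-plane. -/
def cuspSpace (k ℓ : ℕ) : Submodule ℂ (ℍ → ℂ) where
  carrier := {f | ∃ F : CuspForm (CongruenceSubgroup.Gamma0 ℓ : Subgroup (GL (Fin 2) ℝ)) (k : ℤ),
    (F : ℍ → ℂ) = f}
  add_mem' := by
    rintro _ _ ⟨F, rfl⟩ ⟨G, rfl⟩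
    exact ⟨F + G, rfl⟩
  zero_mem' := ⟨0, rfl⟩
  smul_mem' := by
    rintro c _ ⟨F, rfl⟩
    exact ⟨c • F, rfl⟩

/-- The operator `φ ↦ φ|_d`, where `φ|_d (z) = d ^ (k / 2) φ (d z)` (used for `d ≥ 1`). -/
def raise (k d : ℕ) (φ : ℍ → ℂ) : ℍ → ℂ :=
  fun z => (((d : ℝ) ^ ((k : ℝ) / 2) : ℝ) : ℂ) * φ (ofComplex ((d : ℂ) * (z : ℂ)))

/-- The Hecke operator
`T_n φ (z) = n ^ (k - 1) ∑_{a d = n} d ^ (-k) ∑_{0 ≤ b < d} φ ((a z + b) / d)`. -/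
def hecke (k n : ℕ) (φ : ℍ → ℂ) : ℍ → ℂ :=
  fun z => (n : ℂ) ^ ((k : ℤ) - 1) * ∑ d ∈ n.divisors, (d : ℂ) ^ (-(k : ℤ)) *
    ∑ b ∈ Finset.range d, φ (ofComplex ((((n / d : ℕ) : ℂ) * (z : ℂ) + (b : ℂ)) / (d : ℂ)))

/-- A fundamental domain for `Γ₀(ℓ)` (up to overlaps of measure zero): the union of the translates
of the standard fundamental domain `𝒟` of `SL(2, ℤ)` by representatives of the right cosets
`Γ₀(ℓ) γ`, which are the inverses of representatives of the left cosets. -/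
def fundDomain (ℓ : ℕ) : Set ℍ :=
  ⋃ c : SL(2, ℤ) ⧸ CongruenceSubgroup.Gamma0 ℓ, (Quotient.out c)⁻¹ • 𝒟

/-- The invariant measure on `Γ₀(ℓ) \ ℍ`, realized on a fundamental domain: the multiple of
`dx dy / y ^ 2` of total volume `V`. -/
def levelMeasure (V : ℝ) (ℓ : ℕ) : Measure ℍ :=
  (ENNReal.ofReal V / volume (fundDomain ℓ)) • volume.restrict (fundDomain ℓ)

/-- The Petersson inner product
`⟨f, g⟩ = ∫_{Γ₀(ℓ) \ ℍ} conj (f z) g(z) y ^ k` against the measure of total volume `V`. -/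
def peterssonInner (V : ℝ) (k ℓ : ℕ) (f g : ℍ → ℂ) : ℂ :=
  ∫ z, petersson (k : ℤ) f g z ∂(levelMeasure V ℓ)

/-- The oldspace of level `q`: the span of all `φ|_d` with `ℓ ≠ q` a divisor of `q`, `d` a divisor
of `q / ℓ`, and `φ ∈ A(ℓ)`. -/
def oldspace (k q : ℕ) : Submodule ℂ (ℍ → ℂ) :=
  Submodule.span ℂ {f | ∃ ℓ d : ℕ, ℓ ∣ q ∧ ℓ ≠ q ∧ d ∣ q / ℓ ∧
    ∃ φ ∈ cuspSpace k ℓ, f = raise k d φ}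

/-- The newspace `A*(q)`: the orthogonal complement of the oldspace in `A(q)`. -/
def newspace (V : ℝ) (k q : ℕ) : Set (ℍ → ℂ) :=
  {f | f ∈ cuspSpace k q ∧ ∀ g ∈ oldspace k q, peterssonInner V k q g f = 0}

/-- `B` is an orthonormal basis, for the Petersson inner product of level `ℓ`, of the space `W` of
functions. -/
structure IsOrthonormalBasis (V : ℝ) (k ℓ : ℕ) (W : Set (ℍ → ℂ)) (B : Finset (ℍ → ℂ)) : Prop where
  norm_one : ∀ φ ∈ B, peterssonInner V k ℓ φ φ = 1
  orthogonal : ∀ φ ∈ B, ∀ ψ ∈ B, φ ≠ ψ → peterssonInner V k ℓ φ ψ = 0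
  span_eq : (Submodule.span ℂ (B : Set (ℍ → ℂ)) : Set (ℍ → ℂ)) = W

/-- Moderate growth: at every cusp, polynomially bounded in the height. -/
def ModerateGrowth (Ψ : ℍ → ℂ) : Prop :=
  ∃ C A : ℝ, ∀ γ : SL(2, ℤ), ∀ z ∈ 𝒟, ‖Ψ (γ • z)‖ ≤ C * z.im ^ A

end NewformIsolation

end

/-! For `d * m ∣ q`, let P(d, m) be the orthogonal projection of A(q) onto the space of all φ|_d
with φ in A(m). Since inner products are normalized by total volume `V`, they are averages over
fundamental domains, hence independent of the level, and φ ↦ φ|_d is isometric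
(`peterssonInner_raise`). So the raised basis of A(m) is orthonormal, and P(d, m) is x ↦ ∑ ⟨φ|_d, x⟩
φ|_d.

With S(f, g) = ⟨f, Ψ T_n g⟩, a diagonal sum ∑ S(φ, φ) over an orthonormal family depends only on the
projection of the family (`sum_diagonal_eq`). The theorem thus reduces to an identity of operators:
the projection to the newspace is the `isolator` ∑ μ(d) μ(e) P(d, q/(de))
(`projection_newspace_eq`).

The isolator is self-adjoint. On the newspace only d = e = 1 survives, since the other raised spaces
are old, and that term is the identity. It remains to see that it kills the oldspace, which is
spanned by the forms of level q/p and their images under φ ↦ φ|_p, for primes p dividing q. On the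
raised forms the terms d and dp cancel, on the unraised ones the terms e and ep. Both cancellations
come from `projection_eq_of_factor`: forms on the conjugate group G₁ = `levelGroup d m` make up one
raised space, those on a larger group G the other, and w is a form on a third group G₂. If G = G₁
G₂, the normalized trace of w to G is the projection of w to both spaces (`exists_trace`). The
factorizations are explicit matrix computations that need a spare factor p in the level; the cube
condition on q provides it. -/

noncomputable section

namespace NewformIsolation

/-! ### Fundamental domains of subgroups and conjugates, and averages over them. -/

section FundamentalDomain

variable {P α : Type*} [Group P] [MulAction P α] [MeasurableSpace α]
  {μ : Measure α} {G H : Subgroup P} {D D' : Set α} {ι : Type*}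

theorem aedisjoint_smul_of_isFundamentalDomain (hD : IsFundamentalDomain G D μ) {g g' : P}
    (hg : g ∈ G) (hg' : g' ∈ G) (h : g ≠ g') : AEDisjoint μ (g • D) (g' • D) :=
  hD.aedisjoint (i := ⟨g, hg⟩) (j := ⟨g', hg'⟩) (by simpa using h)

theorem aedisjoint_smul_transversal (hD : IsFundamentalDomain G D μ)
    {r : ι → P} (hrG : ∀ i, r i ∈ G) (hr : ∀ g ∈ G, ∃! i, g * (r i)⁻¹ ∈ H) :
    Pairwise (Function.onFun (AEDisjoint μ) fun i => r i • D) := by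
  intro i j hij
  refine aedisjoint_smul_of_isFundamentalDomain hD (hrG i) (hrG j) fun h => hij ?_
  exact (hr _ (hrG i)).unique (by simp [H.one_mem]) (by simp [h, H.one_mem])

variable [MeasurableConstSMul P α] [SMulInvariantMeasure P α μ]

theorem nullMeasurableSet_smul_of_isFundamentalDomain (hD : IsFundamentalDomain G D μ) (g : P) :
    NullMeasurableSet (g • D) μ :=
  hD.nullMeasurableSet.smul g

/-- The translates of a fundamental domain of a group by representatives of the right cosets of a
subgroup make up a fundamental domain of the subgroup. -/
theorem isFundamentalDomain_iUnion_smul [Countable ι] (hHG : H ≤ G)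
    (hD : IsFundamentalDomain G D μ)
    {r : ι → P} (hrG : ∀ i, r i ∈ G) (hr : ∀ g ∈ G, ∃! i, g * (r i)⁻¹ ∈ H) :
    IsFundamentalDomain H (⋃ i, r i • D) μ where
  nullMeasurableSet := .iUnion fun i => nullMeasurableSet_smul_of_isFundamentalDomain hD _
  ae_covers := by
    filter_upwards [hD.ae_covers] with x ⟨g, hg⟩
    obtain ⟨i, hi, -⟩ := hr _ (G.inv_mem g.2)
    refine ⟨⟨(r i * g : P), by simpa using H.inv_mem hi⟩, Set.mem_iUnion.2 ⟨i, ?_⟩⟩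
    rw [Set.mem_smul_set_iff_inv_smul_mem]
    simpa [Subgroup.smul_def, mul_smul] using hg
  aedisjoint := by
    intro h h' hne
    simp only [Function.onFun, Subgroup.smul_def, Set.smul_set_iUnion]
    refine AEDisjoint.iUnion_left_iff.2 fun i => AEDisjoint.iUnion_right_iff.2 fun j => ?_
    rw [smul_smul, smul_smul]
    refine aedisjoint_smul_of_isFundamentalDomain hD (G.mul_mem (hHG h.2) (hrG i))
      (G.mul_mem (hHG h'.2) (hrG j)) fun he => hne ?_
    have hij : i = j := by
      refine (hr _ (hrG i)).unique (by simp [H.one_mem]) ?_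
      have : r i * (r j)⁻¹ = (h : P)⁻¹ * h' := by
        rw [mul_inv_eq_iff_eq_mul, mul_assoc, ← he]; group
      rw [this]
      exact H.mul_mem (H.inv_mem h.2) h'.2
    subst hij
    exact Subtype.ext (mul_right_cancel he)

/-- The quotient type consists of left cosets g H, whereas domains are assembled from right cosets H
g; inverting the representatives passes from one to the other. -/
theorem exists_transversal (G H : Subgroup P) :
    ∃ r : G ⧸ H.subgroupOf G → P, (∀ i, r i ∈ G) ∧ ∀ g ∈ G, ∃! i, g * (r i)⁻¹ ∈ H := by
  refine ⟨fun i => ((Quotient.out i : G) : P)⁻¹, fun i => G.inv_mem (Quotient.out i).2, fun g hg => ?_⟩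
  have key : ∀ i : G ⧸ H.subgroupOf G, g * ((Quotient.out i : G) : P) ∈ H ↔
      ((⟨g, hg⟩⁻¹ : G) : G ⧸ H.subgroupOf G) = i := by
    intro i
    conv_rhs => rw [← Quotient.out_eq i]
    erw [QuotientGroup.eq]
    simp [Subgroup.mem_subgroupOf]
  refine ⟨((⟨g, hg⟩⁻¹ : G) : G ⧸ H.subgroupOf G), ?_, fun i hi => ?_⟩
  · simpa using (key _).2 rfl
  · exact ((key i).1 (by simpa using hi)).symm

theorem exists_isFundamentalDomain_of_relIndex_ne_zero (hHG : H ≤ G)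
    (hfin : H.relIndex G ≠ 0) (hD : IsFundamentalDomain G D μ) :
    ∃ D', IsFundamentalDomain H D' μ := by
  obtain ⟨r, hrG, hr⟩ := exists_transversal G H
  have : Finite (G ⧸ H.subgroupOf G) := Nat.finite_of_card_ne_zero hfin
  exact ⟨_, isFundamentalDomain_iUnion_smul hHG hD hrG hr⟩

theorem setIntegral_smul_set {E : Type*} [NormedAddCommGroup E] [NormedSpace ℝ E]
    (g : P) (D : Set α) (F : α → E) :
    ∫ z in g • D, F z ∂μ = ∫ z in D, F (g • z) ∂μ := by
  rw [← (measurePreserving_smul g μ).setIntegral_preimage_emb (measurableEmbedding_const_smul g),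
    Set.preimage_smul, inv_smul_smul]

theorem integrableOn_smul_set_iff {E : Type*} [NormedAddCommGroup E]
    (g : P) (D : Set α) (F : α → E) :
    IntegrableOn F (g • D) μ ↔ IntegrableOn (fun z => F (g • z)) D μ := by
  have := (measurePreserving_smul g μ).integrableOn_comp_preimage (f := F) (s := g • D)
    (measurableEmbedding_const_smul g)
  rw [Set.preimage_smul, inv_smul_smul] at this
  exact this.symm

theorem setIntegral_iUnion_smul {E : Type*} [NormedAddCommGroup E] [NormedSpace ℝ E] [Fintype ι]
    (hD : IsFundamentalDomain G D μ)
    {r : ι → P} (hrG : ∀ i, r i ∈ G) (hr : ∀ g ∈ G, ∃! i, g * (r i)⁻¹ ∈ H)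
    {F : α → E} (hF : ∀ g ∈ G, ∀ z, F (g • z) = F z) (hint : IntegrableOn F D μ) :
    ∫ z in ⋃ i, r i • D, F z ∂μ = (Fintype.card ι : ℝ) • ∫ z in D, F z ∂μ := by
  have hi : ∀ i, IntegrableOn F (r i • D) μ := fun i => by
    rw [integrableOn_smul_set_iff]
    simpa only [hF _ (hrG i)] using hint
  rw [integral_iUnion_ae (fun i => nullMeasurableSet_smul_of_isFundamentalDomain hD _)
    (aedisjoint_smul_transversal hD hrG hr), tsum_fintype]
  · simp_rw [setIntegral_smul_set, hF _ (hrG _)]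
    simp [Nat.cast_smul_eq_nsmul]
  · exact integrableOn_finite_iUnion.2 hi

theorem measure_iUnion_smul [Fintype ι] (hD : IsFundamentalDomain G D μ)
    {r : ι → P} (hrG : ∀ i, r i ∈ G) (hr : ∀ g ∈ G, ∃! i, g * (r i)⁻¹ ∈ H) :
    μ (⋃ i, r i • D) = Fintype.card ι * μ D := by
  rw [measure_iUnion₀ (aedisjoint_smul_transversal hD hrG hr)
    (fun i => nullMeasurableSet_smul_of_isFundamentalDomain hD _), tsum_fintype]
  simp

/-- The average of an invariant function over a fundamental domain does not change when the group
is replaced by a subgroup of finite index. -/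
theorem setAverage_eq_of_le {E : Type*} [NormedAddCommGroup E] [NormedSpace ℝ E]
    [Countable H] (hHG : H ≤ G) (hfin : H.relIndex G ≠ 0)
    (hD : IsFundamentalDomain G D μ) (hD' : IsFundamentalDomain H D' μ)
    {F : α → E} (hF : ∀ g ∈ G, ∀ z, F (g • z) = F z) (hint : IntegrableOn F D μ) :
    ⨍ z in D', F z ∂μ = ⨍ z in D, F z ∂μ := by
  obtain ⟨r, hrG, hr⟩ := exists_transversal G H
  have : Finite (G ⧸ H.subgroupOf G) := Nat.finite_of_card_ne_zero hfin
  have : Fintype (G ⧸ H.subgroupOf G) := Fintype.ofFinite _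
  have hU := isFundamentalDomain_iUnion_smul hHG hD hrG hr
  have hc : (Fintype.card (G ⧸ H.subgroupOf G) : ℝ) ≠ 0 := by
    rw [← Nat.card_eq_fintype_card]
    exact_mod_cast hfin
  rw [setAverage_eq, setAverage_eq, hD'.setIntegral_eq hU (fun h z => hF _ (hHG h.2) z),
    setIntegral_iUnion_smul hD hrG hr hF hint, measureReal_def, measureReal_def,
    hD'.measure_eq hU, measure_iUnion_smul hD hrG hr, ENNReal.toReal_mul, ENNReal.toReal_natCast,
    smul_smul]
  congr 1
  field_simp

theorem setAverage_smul_set {E : Type*} [NormedAddCommGroup E] [NormedSpace ℝ E]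
    (g : P) (D : Set α) (F : α → E) :
    ⨍ z in g • D, F z ∂μ = ⨍ z in D, F (g • z) ∂μ := by
  rw [setAverage_eq, setAverage_eq, setIntegral_smul_set, measureReal_def, measureReal_def,
    measure_smul]

/-- The translate of a fundamental domain of `H` by `g` is a fundamental domain of `K`, if `K` is
the conjugate of `H` by `g`. -/
theorem isFundamentalDomain_conj_smul {K : Subgroup P} (hD : IsFundamentalDomain H D μ) (g : P)
    (hK : ∀ x, x ∈ K ↔ g⁻¹ * x * g ∈ H) : IsFundamentalDomain K (g • D) μ where
  nullMeasurableSet := nullMeasurableSet_smul_of_isFundamentalDomain hD g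
  ae_covers := by
    have h := (measurePreserving_smul g⁻¹ μ).quasiMeasurePreserving.ae hD.ae_covers
    filter_upwards [h] with x ⟨y, hy⟩
    refine ⟨⟨g * y * g⁻¹, (hK _).2 (by simp [mul_assoc])⟩, ?_⟩
    rw [Set.mem_smul_set_iff_inv_smul_mem]
    simpa [Subgroup.smul_def, mul_smul] using hy
  aedisjoint := by
    intro x y hxy
    have hconj : ∀ x : K, (x : P) • g • D = g • (g⁻¹ * x * g) • D := fun x => by
      simp [smul_smul, mul_assoc]
    simp only [Function.onFun, Subgroup.smul_def, hconj]
    have := aedisjoint_smul_of_isFundamentalDomain hD ((hK _).1 x.2) ((hK _).1 y.2)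
      (by simpa using hxy)
    simp only [AEDisjoint, ← Set.smul_set_inter, measure_smul] at this ⊢
    exact this

end FundamentalDomain

/-! ### The modular group acting on the upper half-plane, and its standard domain. -/

section Moebius

/-- The group of transformations of the upper half-plane given by real matrices. -/
abbrev Mob : Type := (MulAction.toPermHom (GL (Fin 2) ℝ) ℍ).range

/-- The transformation of the upper half-plane given by a matrix. -/
def toMob : GL (Fin 2) ℝ →* Mob := (MulAction.toPermHom (GL (Fin 2) ℝ) ℍ).rangeRestrict

theorem toMob_smul (g : GL (Fin 2) ℝ) (z : ℍ) : toMob g • z = g • z := rfl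

theorem toMob_surjective : Function.Surjective toMob := MonoidHom.rangeRestrict_surjective _

instance : MeasurableConstSMul (GL (Fin 2) ℝ) ℍ :=
  ⟨fun g => (continuous_const_smul g).measurable⟩

instance : MeasurableConstSMul Mob ℍ := ⟨fun g => by
  obtain ⟨g, rfl⟩ := toMob_surjective g
  exact measurable_const_smul g⟩

instance : SMulInvariantMeasure Mob ℍ volume := ⟨fun g s hs => by
  obtain ⟨g, rfl⟩ := toMob_surjective g
  exact measure_preimage_smul_of_nullMeasurableSet (G := GL (Fin 2) ℝ) hs.nullMeasurableSet g⟩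

/-- The matrix -1 acts trivially, so no set of positive measure has almost disjoint translates under
a matrix group containing it. Fundamental domains are therefore taken for the image groups in `Mob`,
and this describes the fibres. -/
theorem toMob_mapGL_eq_iff (g h : SL(2, ℤ)) :
    toMob (Matrix.SpecialLinearGroup.mapGL ℝ g) = toMob (Matrix.SpecialLinearGroup.mapGL ℝ h) ↔
      g = h ∨ g = -h := by
  constructor
  · intro H
    have h2 : ∀ z : ℍ, g • z = h • z := fun z => congrArg (fun x : Mob => x • z) H
    -- The interior point 2i has only ±1 as stabilizer.
    have hz : (⟨2 * Complex.I, by simp⟩ : ℍ) ∈ 𝒟ᵒ := by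
      constructor
      · norm_num
      · simp [UpperHalfPlane.re]
    have h3 := ModularGroup.eq_one_or_neg_one_of_mem_fdo_mem_fdo (g := h⁻¹ * g) hz
      (by rw [mul_smul, h2, inv_smul_smul]; exact hz)
    rcases h3 with h3 | h3
    · left; exact (inv_mul_eq_one.1 h3).symm
    · right
      rw [inv_mul_eq_iff_eq_mul] at h3
      simpa using h3
  · rintro (rfl | rfl)
    · rfl
    · refine Subtype.ext (Equiv.ext fun z => ?_)
      exact ModularGroup.SL_neg_smul h z

theorem volume_setOf_re_eq (c : ℝ) : volume {z : ℍ | z.re = c} = 0 := by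
  rw [volume_eq_lintegral]
  refine setLIntegral_measure_zero _ _ (measure_mono_null (t := {z : ℂ | z.re = c}) ?_ ?_)
  · rintro _ ⟨z, hz, rfl⟩; exact hz
  · have h := Complex.volume_preserving_equiv_real_prod.measure_preimage_equiv ({c} ×ˢ Set.univ)
    rw [Measure.volume_eq_prod, Measure.prod_prod] at h
    simp only [measure_singleton, zero_mul] at h
    rw [← h]
    congr 1
    ext z; simp [Complex.measurableEquivRealProd]

theorem volume_setOf_norm_eq (c : ℝ) : volume {z : ℍ | ‖(z : ℂ)‖ = c} = 0 := by
  rw [volume_eq_lintegral]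
  refine setLIntegral_measure_zero _ _ (measure_mono_null (t := Metric.sphere (0 : ℂ) c) ?_ ?_)
  · rintro _ ⟨z, hz, rfl⟩; simpa using hz
  · exact Measure.addHaar_sphere _ _ _

/-- The boundary lies on the unit circle and two vertical lines. -/
theorem volume_fd_diff_fdo : volume (𝒟 \ 𝒟ᵒ) = 0 := by
  refine measure_mono_null (t := {z : ℍ | ‖(z : ℂ)‖ = 1} ∪
    ({z : ℍ | z.re = 1 / 2} ∪ {z : ℍ | z.re = -(1 / 2)})) ?_ ?_
  · rintro z ⟨⟨h1, h2⟩, h3⟩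
    rcases h1.lt_or_eq with h1 | h1
    · right
      rcases h2.lt_or_eq with h2 | h2
      · exact absurd ⟨h1, h2⟩ h3
      · rcases abs_eq (by norm_num) |>.1 h2 with h | h
        · left; exact h
        · right; exact h
    · left
      simp only [Set.mem_ofPred_eq]
      rw [Complex.normSq_eq_norm_sq] at h1
      nlinarith [norm_nonneg (z : ℂ)]
  · simp [volume_setOf_norm_eq, volume_setOf_re_eq]

theorem measurableSet_fd : MeasurableSet 𝒟 := ModularGroup.isClosed_fd.measurableSet

/-- The standard domain is a fundamental domain of the modular group. -/
theorem isFundamentalDomain_fd :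
    IsFundamentalDomain ((𝒮ℒ : Subgroup (GL (Fin 2) ℝ)).map toMob) 𝒟 volume := by
  refine .mk'' measurableSet_fd.nullMeasurableSet (.of_forall fun z => ?_) (fun g hg => ?_)
    (fun g => (measurePreserving_smul (g : Mob) volume).quasiMeasurePreserving)
  · obtain ⟨g, hg⟩ := ModularGroup.exists_smul_mem_fd z
    exact ⟨⟨toMob (Matrix.SpecialLinearGroup.mapGL ℝ g), _, ⟨g, rfl⟩, rfl⟩, hg⟩
  · obtain ⟨_, _, ⟨g, rfl⟩, rfl⟩ := g
    -- For g ≠ ±1 an interior point of the domain is not moved by g into the domain, so the overlap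
    -- comes from boundary points.
    refine measure_mono_null (t := (𝒟 \ 𝒟ᵒ) ∪
      toMob (Matrix.SpecialLinearGroup.mapGL ℝ g) • (𝒟 \ 𝒟ᵒ)) ?_ ?_
    · rintro z ⟨⟨w, hw, rfl⟩, hz⟩
      by_cases h1 : w ∈ 𝒟ᵒ
      · refine absurd (ModularGroup.eq_one_or_neg_one_of_mem_fdo_mem_fd h1 hz) fun h => hg ?_
        apply Subtype.ext
        have := (toMob_mapGL_eq_iff g 1).2 h
        rw [map_one, map_one] at this
        exact this
      · exact Or.inr ⟨w, ⟨hw, h1⟩, rfl⟩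
    · simp [volume_fd_diff_fdo]

/-- The domain lies in the half-strip |x| ≤ 1/2, y > 1/2, over which y⁻² is integrable. -/
theorem volume_fd_lt_top : volume 𝒟 < ⊤ := by
  have hf : Measurable fun y : ℝ => (((1 / ‖y‖₊) ^ 2 : NNReal) : ENNReal) := by fun_prop
  have h1 : (∫⁻ y in Set.Ioi (1 / 2 : ℝ), (((1 / ‖y‖₊) ^ 2 : NNReal) : ENNReal)) < ⊤ := by
    have h := (integrableOn_Ioi_rpow_of_lt (a := -2) (by norm_num) (c := 1 / 2) (by norm_num)).2
    refine lt_of_eq_of_lt (setLIntegral_congr_fun measurableSet_Ioi fun y hy => ?_) h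
    have hy : (0 : ℝ) < y := lt_trans (by norm_num) hy
    beta_reduce
    rw [enorm_eq_nnnorm, ENNReal.coe_inj]
    ext
    rw [coe_nnnorm, Real.norm_of_nonneg (Real.rpow_nonneg hy.le _)]
    simp [Real.rpow_neg hy.le]
  rw [volume_eq_lintegral]
  calc (∫⁻ z in (↑) '' 𝒟, (((1 / ‖(z : ℂ).im‖₊) ^ 2 : NNReal) : ENNReal))
      ≤ ∫⁻ z in Complex.measurableEquivRealProd ⁻¹' (Set.Icc (-(1 / 2)) (1 / 2) ×ˢ Set.Ioi (1 / 2)),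
          (((1 / ‖(z : ℂ).im‖₊) ^ 2 : NNReal) : ENNReal) := by
        refine lintegral_mono_set ?_
        rintro _ ⟨z, hz, rfl⟩
        have h3 := ModularGroup.three_le_four_mul_im_sq_of_mem_fd hz
        have h4 := z.im_pos
        refine ⟨abs_le.1 hz.2, ?_⟩
        show 1 / 2 < z.im
        nlinarith
    _ = ∫⁻ p in Set.Icc (-(1 / 2) : ℝ) (1 / 2) ×ˢ Set.Ioi (1 / 2 : ℝ),
          (((1 / ‖p.2‖₊) ^ 2 : NNReal) : ENNReal) :=
        Complex.volume_preserving_equiv_real_prod.setLIntegral_comp_preimage_emb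
          Complex.measurableEquivRealProd.measurableEmbedding
          (fun p : ℝ × ℝ => (((1 / ‖p.2‖₊) ^ 2 : NNReal) : ENNReal)) _
    _ = (∫⁻ _ in Set.Icc (-(1 / 2) : ℝ) (1 / 2), 1) *
          ∫⁻ y in Set.Ioi (1 / 2 : ℝ), (((1 / ‖y‖₊) ^ 2 : NNReal) : ENNReal) := by
        rw [Measure.volume_eq_prod, ← Measure.prod_restrict,
          ← lintegral_prod_mul (by fun_prop) hf.aemeasurable]
        simp
    _ < ⊤ := ENNReal.mul_lt_top (by simp) h1

instance : Countable SL(2, ℤ) :=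
  Function.Injective.countable (f := fun g : SL(2, ℤ) => fun i j : Fin 2 => g i j)
    fun _ _ H => Matrix.SpecialLinearGroup.ext _ _ fun i j => congrFun (congrFun H i) j

/-- The group `Γ₀(ℓ)` as a group of real matrices. -/
abbrev gamma0 (ℓ : ℕ) : Subgroup (GL (Fin 2) ℝ) :=
  (CongruenceSubgroup.Gamma0 ℓ).map (Matrix.SpecialLinearGroup.mapGL ℝ)

theorem neg_mem_Gamma0 {ℓ : ℕ} {g : SL(2, ℤ)} (hg : g ∈ CongruenceSubgroup.Gamma0 ℓ) :
    -g ∈ CongruenceSubgroup.Gamma0 ℓ := by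
  rw [CongruenceSubgroup.Gamma0_mem] at hg ⊢
  simpa using hg

theorem toMob_mapGL_mem_iff {ℓ : ℕ} (g : SL(2, ℤ)) :
    toMob (Matrix.SpecialLinearGroup.mapGL ℝ g) ∈ (gamma0 ℓ).map toMob ↔
      g ∈ CongruenceSubgroup.Gamma0 ℓ := by
  constructor
  · rintro ⟨_, ⟨h, hh, rfl⟩, he⟩
    rcases (toMob_mapGL_eq_iff h g).1 he with rfl | rfl
    · exact hh
    · simpa using neg_mem_Gamma0 hh
  · intro h
    exact ⟨_, ⟨g, h, rfl⟩, rfl⟩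

theorem gamma0_le_range (ℓ : ℕ) : gamma0 ℓ ≤ 𝒮ℒ := by
  rintro _ ⟨g, -, rfl⟩; exact ⟨g, rfl⟩

theorem fundDomain_eq (ℓ : ℕ) : fundDomain ℓ = ⋃ c : SL(2, ℤ) ⧸ CongruenceSubgroup.Gamma0 ℓ,
    toMob (Matrix.SpecialLinearGroup.mapGL ℝ (Quotient.out c)⁻¹) • 𝒟 := rfl

theorem isFundamentalDomain_fundDomain (ℓ : ℕ) :
    IsFundamentalDomain ((gamma0 ℓ).map toMob) (fundDomain ℓ) volume := by
  have : Countable (SL(2, ℤ) ⧸ CongruenceSubgroup.Gamma0 ℓ) := Quotient.countable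
  rw [fundDomain_eq]
  refine isFundamentalDomain_iUnion_smul (Subgroup.map_mono (gamma0_le_range ℓ))
    isFundamentalDomain_fd (fun i => ⟨_, ⟨_, rfl⟩, rfl⟩) ?_
  rintro _ ⟨_, ⟨g, rfl⟩, rfl⟩
  have key : ∀ i : SL(2, ℤ) ⧸ CongruenceSubgroup.Gamma0 ℓ,
      toMob (Matrix.SpecialLinearGroup.mapGL ℝ g) *
        (toMob (Matrix.SpecialLinearGroup.mapGL ℝ (Quotient.out i)⁻¹))⁻¹ ∈
          (gamma0 ℓ).map toMob ↔ ((g⁻¹ : SL(2, ℤ)) : SL(2, ℤ) ⧸ CongruenceSubgroup.Gamma0 ℓ) = i := by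
    intro i
    rw [← map_inv, ← map_inv, ← map_mul, ← map_mul, toMob_mapGL_mem_iff, inv_inv]
    conv_rhs => rw [← Quotient.out_eq i]
    erw [QuotientGroup.eq]
    rw [inv_inv]
  exact ⟨_, (key _).2 rfl, fun i hi => ((key i).1 hi).symm⟩

instance (Γ : Subgroup SL(2, ℤ)) :
    Countable ((Γ.map (Matrix.SpecialLinearGroup.mapGL ℝ)).map toMob) := by
  have := (Set.to_countable (Γ : Set SL(2, ℤ))).image (Matrix.SpecialLinearGroup.mapGL ℝ)
  exact (this.image toMob).to_subtype

theorem volume_fundDomain_lt_top {ℓ : ℕ} (hℓ : ℓ ≠ 0) : volume (fundDomain ℓ) < ⊤ := by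
  have : NeZero ℓ := ⟨hℓ⟩
  have : Finite (SL(2, ℤ) ⧸ CongruenceSubgroup.Gamma0 ℓ) :=
    Subgroup.finite_quotient_of_finiteIndex
  have : Fintype (SL(2, ℤ) ⧸ CongruenceSubgroup.Gamma0 ℓ) := Fintype.ofFinite _
  rw [fundDomain_eq]
  refine (measure_iUnion_le _).trans_lt ?_
  rw [tsum_fintype]
  refine ENNReal.sum_lt_top.2 fun i _ => ?_
  rw [measure_smul]
  exact volume_fd_lt_top

/-- As `V` times an average, the inner product no longer sees the index of the level group. -/
theorem peterssonInner_eq {V : ℝ} (hV : 0 < V) (k ℓ : ℕ) (f g : ℍ → ℂ) :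
    peterssonInner V k ℓ f g = (V : ℂ) * ⨍ z in fundDomain ℓ, petersson k f g z := by
  rw [peterssonInner, levelMeasure, integral_smul_measure, setAverage_eq, ENNReal.toReal_div,
    ENNReal.toReal_ofReal hV.le, div_eq_mul_inv, mul_smul, measureReal_def]
  simp

end Moebius

/-! ### Affine maps z ↦ a z + b with rational coefficients. -/

section AffineMaps

/-- The rational matrix of `z ↦ a z + b`, for `a ≠ 0`. -/
def affineMatrix (a b : ℚ) : GL (Fin 2) ℚ :=
  if h : a = 0 then 1 else Matrix.GeneralLinearGroup.mkOfDetNeZero !![a, b; 0, 1] (by simpa using h)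

/-- The real matrix of `z ↦ a z + b`, for rational `a ≠ 0` and `b`. -/
def affineMap (a b : ℚ) : GL (Fin 2) ℝ := (affineMatrix a b).map (Rat.castHom ℝ)

variable {a : ℚ} (b : ℚ)

theorem affineMap_val (ha : a ≠ 0) : (affineMap a b).val = !![(a : ℝ), (b : ℝ); 0, 1] := by
  ext i j
  fin_cases i <;> fin_cases j <;>
    simp [affineMap, affineMatrix, ha, Matrix.GeneralLinearGroup.mkOfDetNeZero]

theorem affineMap_det (ha : a ≠ 0) : (affineMap a b).det.val = (a : ℝ) := by
  rw [Matrix.GeneralLinearGroup.val_det_apply, affineMap_val b ha]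
  simp

theorem affineMap_denom (ha : a ≠ 0) (z : ℂ) : denom (affineMap a b) z = 1 := by
  simp [denom, affineMap_val b ha]

theorem coe_affineMap_smul (ha : 0 < a) (z : ℍ) : ((affineMap a b • z : ℍ) : ℂ) = a * z + b := by
  rw [coe_smul_of_det_pos (by rw [affineMap_det b ha.ne']; exact_mod_cast ha),
    affineMap_denom b ha.ne']
  simp [num, affineMap_val b ha.ne']

theorem im_affineMap_smul (ha : 0 < a) (z : ℍ) : (affineMap a b • z).im = a * z.im := by
  have := congrArg Complex.im (coe_affineMap_smul b ha z)
  simpa using this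

theorem ofComplex_affine (ha : 0 < a) (z : ℍ) :
    ofComplex ((a : ℂ) * (z : ℂ) + (b : ℂ)) = affineMap a b • z := by
  rw [← coe_affineMap_smul b ha, ofComplex_apply]

theorem slash_affineMap (ha : 0 < a) (k : ℤ) (f : ℍ → ℂ) (z : ℍ) :
    (f ∣[k] affineMap a b) z = (a : ℂ) ^ (k - 1) * f (affineMap a b • z) := by
  have h : (0 : ℝ) < a := by exact_mod_cast ha
  rw [ModularForm.slash_apply, affineMap_denom b ha.ne', affineMap_det b ha.ne', abs_of_pos h]
  have hσ : σ (affineMap a b) = .refl ℝ ℂ := by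
    rw [σ, if_pos (by rw [affineMap_det b ha.ne']; exact h)]
  rw [hσ]
  simp [mul_comm]

end AffineMaps

/-! ### The operators φ ↦ φ|_d and the conjugates of Γ₀(m). -/

section Raise

variable {k d m q : ℕ}

theorem raise_apply (hd : d ≠ 0) (φ : ℍ → ℂ) (z : ℍ) :
    raise k d φ z = (((d : ℝ) ^ ((k : ℝ) / 2) : ℝ) : ℂ) * φ (affineMap d 0 • z) := by
  have := ofComplex_affine (a := d) 0 (by positivity) z
  simp only [Rat.cast_natCast, Rat.cast_zero, add_zero] at this
  rw [raise, this]

theorem raise_one (φ : ℍ → ℂ) : raise k 1 φ = φ := by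
  ext z
  simp [raise]

theorem raise_add (φ ψ : ℍ → ℂ) : raise k d (φ + ψ) = raise k d φ + raise k d ψ := by
  ext z
  simp [raise, mul_add]

theorem raise_smul (c : ℂ) (φ : ℍ → ℂ) : raise k d (c • φ) = c • raise k d φ := by
  ext z
  simp [raise, mul_left_comm]

/-- The operator `φ ↦ φ|_d` as a linear map. -/
def raiseHom (k d : ℕ) : (ℍ → ℂ) →ₗ[ℂ] (ℍ → ℂ) where
  toFun := raise k d
  map_add' := raise_add
  map_smul' := raise_smul

theorem raise_raise {d e : ℕ} (hd : d ≠ 0) (he : e ≠ 0) (φ : ℍ → ℂ) :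
    raise k d (raise k e φ) = raise k (d * e) φ := by
  ext z
  rw [raise_apply hd, raise_apply he, raise_apply (mul_ne_zero hd he), ← mul_assoc]
  congr 2
  · rw [← Complex.ofReal_mul, ← Real.mul_rpow (by positivity) (by positivity)]
    push_cast; rfl
  · apply UpperHalfPlane.ext
    have h1 : (0 : ℚ) < d := by positivity
    have h2 : (0 : ℚ) < e := by positivity
    rw [coe_affineMap_smul _ h2, coe_affineMap_smul _ h1, coe_affineMap_smul _ (by positivity)]
    push_cast; ring

/-- The two factors d^(k/2) combine to the d^k in Im(dz)^k = d^k y^k. -/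
theorem petersson_raise (hd : d ≠ 0) (f g : ℍ → ℂ) (z : ℍ) :
    petersson k (raise k d f) (raise k d g) z = petersson k f g (affineMap d 0 • z) := by
  have h : ((((d : ℝ) ^ ((k : ℝ) / 2) : ℝ) : ℂ)) * (((d : ℝ) ^ ((k : ℝ) / 2) : ℝ) : ℂ) =
      (d : ℂ) ^ k := by
    rw [← Complex.ofReal_mul, ← Real.rpow_add (by positivity), add_halves, Real.rpow_natCast]
    push_cast; rfl
  rw [petersson, petersson, raise_apply hd, raise_apply hd, im_affineMap_smul _ (by positivity)]
  simp only [map_mul, Complex.conj_ofReal]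
  push_cast
  rw [zpow_natCast, zpow_natCast, mul_pow, ← h]
  ring

/-- `f` is a cusp form of weight `k` on `Γ`. -/
def IsCuspOn (k : ℕ) (Γ : Subgroup (GL (Fin 2) ℝ)) (f : ℍ → ℂ) : Prop :=
  ∃ F : CuspForm Γ (k : ℤ), (F : ℍ → ℂ) = f

theorem IsCuspOn.mono {Γ Γ' : Subgroup (GL (Fin 2) ℝ)} (h : Γ' ≤ Γ) {f : ℍ → ℂ}
    (hf : IsCuspOn k Γ f) : IsCuspOn k Γ' f := by
  obtain ⟨F, rfl⟩ := hf
  exact ⟨{ toFun := F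
           slash_action_eq' := fun g hg => F.slash_action_eq' g (h hg)
           holo' := F.holo'
           zero_at_cusps' := fun hc => F.zero_at_cusps' (hc.mono h) }, rfl⟩

theorem IsCuspOn.smul {Γ : Subgroup (GL (Fin 2) ℝ)} [Γ.HasDetOne] {f : ℍ → ℂ}
    (hf : IsCuspOn k Γ f) (c : ℂ) : IsCuspOn k Γ (c • f) := by
  obtain ⟨F, rfl⟩ := hf
  exact ⟨c • F, rfl⟩

open ConjAct in
theorem IsCuspOn.slash {Γ : Subgroup (GL (Fin 2) ℝ)} {f : ℍ → ℂ}
    (hf : IsCuspOn k Γ f) (g : GL (Fin 2) ℝ) :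
    IsCuspOn k (toConjAct g⁻¹ • Γ) (f ∣[(k : ℤ)] g) := by
  obtain ⟨F, rfl⟩ := hf
  exact ⟨CuspForm.translate F g, rfl⟩

theorem IsCuspOn.continuous {Γ : Subgroup (GL (Fin 2) ℝ)} {f : ℍ → ℂ}
    (hf : IsCuspOn k Γ f) : Continuous f := by
  obtain ⟨F, rfl⟩ := hf
  exact F.holo'.continuous

open ConjAct in
/-- The group of the matrices `(a, b / d; c m d, e)` of determinant one, with integers
`a`, `b`, `c` and `e`. -/
def levelGroup (d m : ℕ) : Subgroup (GL (Fin 2) ℝ) := toConjAct (affineMap d 0)⁻¹ • gamma0 m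

instance (d m : ℕ) : (levelGroup d m).HasDetOne := by
  unfold levelGroup; infer_instance

/-- Conjugation by a rational matrix preserves arithmeticity; this is why `affineMap` is built from
`affineMatrix`. -/
theorem isArithmetic_levelGroup (d : ℕ) (hm : m ≠ 0) : (levelGroup d m).IsArithmetic := by
  have : NeZero m := ⟨hm⟩
  have := Subgroup.IsArithmetic.conj (gamma0 m) (affineMatrix d 0)⁻¹
  rwa [map_inv] at this

theorem mem_levelGroup_iff {g : GL (Fin 2) ℝ} :
    g ∈ levelGroup d m ↔ affineMap d 0 * g * (affineMap d 0)⁻¹ ∈ gamma0 m := by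
  rw [levelGroup, Subgroup.mem_pointwise_smul_iff_inv_smul_mem, ← map_inv, inv_inv,
    ConjAct.smul_def]
  rfl

theorem mem_levelGroup (hd : d ≠ 0) {g : GL (Fin 2) ℝ} :
    g ∈ levelGroup d m ↔ ∃ a b c e : ℤ, a * e - b * (c * m) = 1 ∧
      g.val = !![(a : ℝ), b / d; c * m * d, (e : ℝ)] := by
  have hd' : (d : ℝ) ≠ 0 := by exact_mod_cast hd
  have hdq : (d : ℚ) ≠ 0 := by exact_mod_cast hd
  have key : ∀ h : GL (Fin 2) ℝ, affineMap d 0 * g * (affineMap d 0)⁻¹ = h ↔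
      (affineMap d 0).val * g.val = h.val * (affineMap d 0).val := by
    intro h
    rw [mul_inv_eq_iff_eq_mul, ← Units.val_inj]
    simp
  rw [mem_levelGroup_iff]
  constructor
  · rintro ⟨h, hh, he⟩
    have he := (key _).1 he.symm
    rw [affineMap_val _ hdq] at he
    obtain ⟨c, hc⟩ := (ZMod.intCast_zmod_eq_zero_iff_dvd _ _).1 (CongruenceSubgroup.Gamma0_mem.1 hh)
    have hdet := h.det_coe
    rw [Matrix.det_fin_two, hc] at hdet
    have h00 := congrFun (congrFun he 0) 0
    have h01 := congrFun (congrFun he 0) 1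
    have h10 := congrFun (congrFun he 1) 0
    have h11 := congrFun (congrFun he 1) 1
    simp [Matrix.mul_apply, Fin.sum_univ_two, hc] at h00 h01 h10 h11
    refine ⟨h 0 0, h 0 1, c, h 1 1, by linear_combination hdet, ?_⟩
    ext i j
    fin_cases i <;> fin_cases j
    · simp; field_simp at h00; tauto
    · simp; field_simp; linarith
    · simp; linarith
    · simpa using h11
  · rintro ⟨a, b, c, e, hdet, hg⟩
    refine ⟨⟨!![a, b; c * m, e], by rw [Matrix.det_fin_two_of]; exact hdet⟩, ?_, ?_⟩
    · exact CongruenceSubgroup.Gamma0_mem.2 (by simp)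
    · refine ((key _).2 ?_).symm
      have hv : (Matrix.SpecialLinearGroup.mapGL ℝ (⟨!![a, b; c * m, e], by
          rw [Matrix.det_fin_two_of]; exact hdet⟩ : SL(2, ℤ))).val = !![(a : ℝ), b; c * m, e] := by
        ext i j
        fin_cases i <;> fin_cases j
        · rfl
        · rfl
        · exact (Int.cast_mul c m).trans (by push_cast; rfl)
        · rfl
      rw [affineMap_val _ hdq, hg, hv]
      ext i j
      fin_cases i <;> fin_cases j <;> simp [Matrix.mul_apply, Fin.sum_univ_two] <;> field_simp

theorem levelGroup_one (m : ℕ) : levelGroup 1 m = gamma0 m := by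
  have : affineMap 1 0 = 1 := by
    ext i j
    rw [affineMap_val _ one_ne_zero]
    fin_cases i <;> fin_cases j <;> simp
  rw [levelGroup, Nat.cast_one, this]
  simp

/-- In the matrix description, `d` bounds the denominator of the upper right entry, and `d * m`
divides the lower left one. -/
theorem levelGroup_mono {d' m' : ℕ} (hd' : d' ≠ 0) (h1 : d ∣ d')
    (h2 : d' * m' ∣ d * m) : levelGroup d m ≤ levelGroup d' m' := by
  have hd : d ≠ 0 := fun h => hd' (by simpa [h] using h1)
  have hdr : (d : ℝ) ≠ 0 := by exact_mod_cast hd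
  intro g hg
  obtain ⟨a, b, c, e, hdet, hg⟩ := (mem_levelGroup hd).1 hg
  obtain ⟨x, rfl⟩ := h1
  obtain ⟨y, hy⟩ := h2
  have hx : x ≠ 0 := fun h => hd' (by simp [h])
  have hxr : (x : ℝ) ≠ 0 := by exact_mod_cast hx
  have hy' : m = x * m' * y := by
    apply Nat.eq_of_mul_eq_mul_left (Nat.pos_of_ne_zero hd); rw [hy]; ring
  subst hy'
  refine (mem_levelGroup hd').2 ⟨a, b * x, c * y, e, ?_, ?_⟩
  · rw [← hdet]; push_cast; ring
  · rw [hg]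
    ext i j
    fin_cases i <;> fin_cases j <;> simp
    · field_simp
    · ring

theorem gamma0_le_levelGroup (hd : d ≠ 0) (h : d * m ∣ q) : gamma0 q ≤ levelGroup d m := by
  rw [← levelGroup_one]
  exact levelGroup_mono hd (one_dvd _) (by simpa using h)

theorem raise_eq_smul_slash (hd : d ≠ 0) (φ : ℍ → ℂ) :
    raise k d φ = ((((d : ℝ) ^ ((k : ℝ) / 2) : ℝ) : ℂ) / (d : ℂ) ^ ((k : ℤ) - 1)) •
      (φ ∣[(k : ℤ)] affineMap d 0) := by
  have hd' : (d : ℂ) ≠ 0 := by exact_mod_cast hd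
  ext z
  rw [Pi.smul_apply, slash_affineMap _ (by positivity), raise_apply hd, smul_eq_mul]
  push_cast
  rw [← mul_assoc, div_mul_cancel₀ _ (zpow_ne_zero _ hd')]

/-- The functions `φ|_d`, with `φ` in `A(m)`, are the cusp forms on the conjugate group. -/
theorem isCuspOn_levelGroup_iff (hd : d ≠ 0) {f : ℍ → ℂ} :
    IsCuspOn k (levelGroup d m) f ↔ ∃ φ ∈ cuspSpace k m, f = raise k d φ := by
  have hd' : (d : ℂ) ≠ 0 := by exact_mod_cast hd
  constructor
  · intro h
    have hr : (((d : ℝ) ^ ((k : ℝ) / 2) : ℝ) : ℂ) ≠ 0 := by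
      rw [Complex.ofReal_ne_zero]; positivity
    set c : ℂ := (((d : ℝ) ^ ((k : ℝ) / 2) : ℝ) : ℂ) / (d : ℂ) ^ ((k : ℤ) - 1) with hc
    have hc0 : c ≠ 0 := div_ne_zero hr (zpow_ne_zero _ hd')
    have h2 := h.slash (affineMap d 0)⁻¹
    rw [levelGroup, smul_smul, ← map_mul, inv_inv, mul_inv_cancel, map_one, one_smul] at h2
    refine ⟨c⁻¹ • (f ∣[(k : ℤ)] (affineMap d 0)⁻¹), h2.smul _, ?_⟩
    rw [raise_smul, raise_eq_smul_slash hd, ← hc, smul_smul, inv_mul_cancel₀ hc0, one_smul,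
      ← SlashAction.slash_mul, inv_mul_cancel, SlashAction.slash_one]
  · rintro ⟨φ, hφ, rfl⟩
    rw [raise_eq_smul_slash hd]
    exact (IsCuspOn.slash hφ _).smul _

theorem raise_mem_cuspSpace (hd : d ≠ 0) (h : d * m ∣ q) {φ : ℍ → ℂ} (hφ : φ ∈ cuspSpace k m) :
    raise k d φ ∈ cuspSpace k q :=
  IsCuspOn.mono (gamma0_le_levelGroup hd h) ((isCuspOn_levelGroup_iff hd).2 ⟨φ, hφ, rfl⟩)

end Raise

/-! ### Petersson products as averages, and averages over translates. -/

section Averages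

variable {k d m q : ℕ}

theorem relIndex_map_ne_zero {A B : Type*} [Group A] [Group B] (f : A →* B) {H G : Subgroup A}
    (h : H.relIndex G ≠ 0) : (H.map f).relIndex (G.map f) ≠ 0 := by
  rw [← Subgroup.relIndex_comap]
  exact fun h0 => h (Nat.eq_zero_of_zero_dvd
    (h0 ▸ Subgroup.relIndex_dvd_of_le_left G (Subgroup.le_comap_map f H)))

theorem relIndex_ne_zero_of_isArithmetic (H G : Subgroup (GL (Fin 2) ℝ)) [hH : H.IsArithmetic]
    [hG : G.IsArithmetic] : H.relIndex G ≠ 0 :=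
  (hH.is_commensurable.trans hG.is_commensurable.symm).1

theorem isArithmetic_gamma0 (hq : q ≠ 0) : (gamma0 q).IsArithmetic := by
  have : NeZero q := ⟨hq⟩
  infer_instance

theorem exists_petersson_le (hq : q ≠ 0) {f g : ℍ → ℂ} (hf : f ∈ cuspSpace k q)
    (hg : g ∈ cuspSpace k q) : ∃ C, ∀ z, ‖petersson k f g z‖ ≤ C := by
  have := isArithmetic_gamma0 hq
  obtain ⟨F, rfl⟩ := hf
  obtain ⟨G, rfl⟩ := hg
  exact CuspFormClass.petersson_bounded_left k (gamma0 q) F G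

theorem continuous_petersson {f g : ℍ → ℂ} (hf : f ∈ cuspSpace k q)
    (hg : g ∈ cuspSpace k q) : Continuous (petersson k f g) :=
  petersson_continuous _ (IsCuspOn.continuous hf) (IsCuspOn.continuous hg)

theorem integrableOn_of_bounded {F : ℍ → ℂ} (hF : Continuous F) (hb : ∃ C, ∀ z, ‖F z‖ ≤ C)
    {D : Set ℍ} (hD : volume D < ⊤) : IntegrableOn F D := by
  obtain ⟨C, hC⟩ := hb
  exact Measure.integrableOn_of_bounded hD.ne hF.aestronglyMeasurable (.of_forall hC)

theorem integrable_petersson (V : ℝ) (hq : q ≠ 0) {f g : ℍ → ℂ} (hf : f ∈ cuspSpace k q)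
    (hg : g ∈ cuspSpace k q) : Integrable (petersson k f g) (levelMeasure V q) := by
  -- The normalizing factor V / volume must be finite; for a null domain the restricted measure
  -- vanishes anyway.
  by_cases h0 : volume (fundDomain q) = 0
  · rw [levelMeasure, Measure.restrict_eq_zero.2 h0, smul_zero]
    exact integrable_zero_measure
  · exact (integrableOn_of_bounded (continuous_petersson hf hg) (exists_petersson_le hq hf hg)
      (volume_fundDomain_lt_top hq)).smul_measure (ENNReal.div_ne_top ENNReal.ofReal_ne_top h0)

theorem petersson_smul_of_isCuspOn {Γ : Subgroup (GL (Fin 2) ℝ)} [Γ.HasDetOne] {f g : ℍ → ℂ}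
    (hf : IsCuspOn k Γ f) (hg : IsCuspOn k Γ g) {γ : Mob} (hγ : γ ∈ Γ.map toMob) (z : ℍ) :
    petersson k f g (γ • z) = petersson k f g z := by
  obtain ⟨γ, hγ, rfl⟩ := hγ
  obtain ⟨F, rfl⟩ := hf
  obtain ⟨G, rfl⟩ := hg
  exact SlashInvariantFormClass.petersson_smul hγ

theorem isFundamentalDomain_levelGroup (d m : ℕ) :
    IsFundamentalDomain ((levelGroup d m).map toMob)
      ((toMob (affineMap d 0))⁻¹ • fundDomain m) volume := by
  refine isFundamentalDomain_conj_smul (isFundamentalDomain_fundDomain m) _ fun x => ?_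
  rw [inv_inv]
  constructor
  · rintro ⟨g, hg, rfl⟩
    exact ⟨_, mem_levelGroup_iff.1 hg, by simp⟩
  · rintro ⟨g, hg, he⟩
    refine ⟨(affineMap d 0)⁻¹ * g * affineMap d 0, mem_levelGroup_iff.2 ?_, ?_⟩
    · simpa [mul_assoc] using hg
    · simp [he, mul_assoc]

/-- The operator `φ ↦ φ|_d` preserves the normalized Petersson inner products. -/
theorem peterssonInner_raise {V : ℝ} (hV : 0 < V) (hd : d ≠ 0) (hq : q ≠ 0) (h : d * m ∣ q)
    {f g : ℍ → ℂ} (hf : f ∈ cuspSpace k m) (hg : g ∈ cuspSpace k m) :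
    peterssonInner V k q (raise k d f) (raise k d g) = peterssonInner V k m f g := by
  have hm : m ≠ 0 := fun h0 => hq (by simpa [h0] using h)
  have := isArithmetic_gamma0 hq
  have := isArithmetic_levelGroup d hm
  have hf' := (isCuspOn_levelGroup_iff (k := k) (m := m) hd).2 ⟨f, hf, rfl⟩
  have hg' := (isCuspOn_levelGroup_iff (k := k) (m := m) hd).2 ⟨g, hg, rfl⟩
  have hf2 := raise_mem_cuspSpace hd h hf
  have hg2 := raise_mem_cuspSpace hd h hg
  rw [peterssonInner_eq hV, peterssonInner_eq hV,
    setAverage_eq_of_le (Subgroup.map_mono (gamma0_le_levelGroup hd h))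
      (relIndex_map_ne_zero toMob (relIndex_ne_zero_of_isArithmetic _ _))
      (isFundamentalDomain_levelGroup d m) (isFundamentalDomain_fundDomain q)
      (fun γ hγ z => petersson_smul_of_isCuspOn hf' hg' hγ z)
      (integrableOn_of_bounded (continuous_petersson hf2 hg2) (exists_petersson_le hq hf2 hg2)
        (by rw [measure_smul]; exact volume_fundDomain_lt_top hm)),
    setAverage_smul_set]
  congr 2
  ext z
  rw [petersson_raise hd, ← toMob_smul, smul_inv_smul]

/-- Averaging over translates by a group in which the level group has finite index. -/
theorem setAverage_sum_smul (hq : q ≠ 0) {G : Subgroup (GL (Fin 2) ℝ)} [G.IsArithmetic]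
    (hG : gamma0 q ≤ G) {F T : ℍ → ℂ} (hF : Continuous F) (hb : ∃ C, ∀ z, ‖F z‖ ≤ C)
    (hFi : ∀ γ ∈ (gamma0 q).map toMob, ∀ z, F (γ • z) = F z)
    (hTi : ∀ γ ∈ (gamma0 q).map toMob, ∀ z, T (γ • z) = T z)
    {ι : Type*} [Fintype ι] (r : ι → GL (Fin 2) ℝ) (hr : ∀ i, r i ∈ G)
    (hT : ∀ z, T z = ∑ i, F (r i • z)) :
    ⨍ z in fundDomain q, T z = Fintype.card ι * ⨍ z in fundDomain q, F z := by
  have := isArithmetic_gamma0 hq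
  set H' := (gamma0 q).map toMob with hH'
  set G' := G.map toMob with hG'
  have hHG : H' ≤ G' := Subgroup.map_mono hG
  have hfin : H'.relIndex G' ≠ 0 :=
    relIndex_map_ne_zero toMob (relIndex_ne_zero_of_isArithmetic _ _)
  -- The r i need not normalize Γ₀(q). They normalize its normal core in `G`, which still has finite
  -- index, so they carry a fundamental domain of the core to another one.
  set N := (H'.subgroupOf G').normalCore with hN
  set K := N.map G'.subtype with hK
  have hKH : K ≤ H' := by
    rintro _ ⟨x, hx, rfl⟩
    exact (Subgroup.normalCore_le _ hx : x ∈ H'.subgroupOf G')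
  have hKG : K.relIndex G' ≠ 0 := by
    have : (H'.subgroupOf G').FiniteIndex := ⟨hfin⟩
    have h1 : N.index ≠ 0 := Subgroup.FiniteIndex.index_ne_zero
    rwa [Subgroup.relIndex, hK, ← Subgroup.comap_subtype,
      Subgroup.comap_map_eq_self_of_injective G'.subtype_injective]
  have hKH' : K.relIndex H' ≠ 0 := fun h0 => hKG (by
    rw [← Subgroup.relIndex_mul_relIndex K H' G' hKH hHG, h0, zero_mul])
  have hcK : Countable K := Function.Injective.countable (f := fun x : K => (⟨x, hKH x.2⟩ : H'))
    fun x y h => Subtype.ext (congrArg (fun z : H' => (z : Mob)) h)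
  have hD := isFundamentalDomain_fundDomain q
  obtain ⟨D, hDK⟩ := exists_isFundamentalDomain_of_relIndex_ne_zero hKH hKH' hD
  have hconj : ∀ i, IsFundamentalDomain K (toMob (r i) • D) volume := fun i => by
    refine isFundamentalDomain_conj_smul hDK _ fun x => ?_
    have hri : toMob (r i) ∈ G' := ⟨_, hr i, rfl⟩
    constructor
    · rintro ⟨y, hy, rfl⟩
      refine ⟨(⟨_, hri⟩ : G')⁻¹ * y * ⟨_, hri⟩, ?_, by simp⟩
      simpa using (inferInstance : N.Normal).conj_mem y hy (⟨_, hri⟩ : G')⁻¹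
    · rintro ⟨y, hy, he⟩
      refine ⟨(⟨_, hri⟩ : G') * y * (⟨_, hri⟩ : G')⁻¹,
        (inferInstance : N.Normal).conj_mem y hy _, ?_⟩
      simp only [Subgroup.subtype_apply] at he
      simp [he, mul_assoc]
  have hTc : Continuous T := by
    rw [show T = fun z => ∑ i, F (r i • z) from funext hT]
    exact continuous_finsetSum _ fun i _ => hF.comp (continuous_const_smul _)
  have hTb : ∃ C, ∀ z, ‖T z‖ ≤ C := by
    obtain ⟨C, hC⟩ := hb
    refine ⟨∑ _i : ι, C, fun z => ?_⟩
    rw [hT]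
    exact norm_sum_le_of_le _ fun i _ => hC _
  have hvol := volume_fundDomain_lt_top hq
  have hDvol : volume D < ⊤ := by
    obtain ⟨s, hsG, hs⟩ := exists_transversal H' K
    have : Finite (H' ⧸ K.subgroupOf H') := Nat.finite_of_card_ne_zero hKH'
    have : Fintype (H' ⧸ K.subgroupOf H') := Fintype.ofFinite _
    rw [hDK.measure_eq (isFundamentalDomain_iUnion_smul hKH hD hsG hs),
      measure_iUnion_smul hD hsG hs]
    exact ENNReal.mul_lt_top (ENNReal.natCast_lt_top _) hvol
  have e1 := setAverage_eq_of_le hKH hKH' hD hDK hTi (integrableOn_of_bounded hTc hTb hvol)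
  have e2 := setAverage_eq_of_le hKH hKH' hD hDK hFi (integrableOn_of_bounded hF hb hvol)
  rw [← e1, ← e2, setAverage_eq, setAverage_eq]
  have e3 : ∫ z in D, T z = ∑ i : ι, ∫ z in D, F z := by
    simp_rw [hT]
    rw [integral_finsetSum]
    · refine Finset.sum_congr rfl fun i _ => ?_
      have := setIntegral_smul_set (μ := volume) (toMob (r i)) D F
      simp only [toMob_smul] at this
      rw [← this]
      exact (hconj i).setIntegral_eq hDK fun x z => hFi _ (hKH x.2) z
    · intro i _
      obtain ⟨C, hC⟩ := hb
      exact integrableOn_of_bounded (hF.comp (continuous_const_smul _)) ⟨C, fun z => hC _⟩ hDvol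
  rw [e3]
  simp
  ring

end Averages

/-! ### Traces between level groups, and factorizations of these groups. -/

section Trace

variable {k d e m p q : ℕ}

theorem petersson_slash_of_det_eq_one (f g : ℍ → ℂ) {γ : GL (Fin 2) ℝ} (hγ : γ.det = 1) (z : ℍ) :
    petersson k (f ∣[(k : ℤ)] γ) (g ∣[(k : ℤ)] γ) z = petersson k f g (γ • z) := by
  have hσ : σ γ = .refl ℝ ℂ := by
    rw [σ, if_pos (by rw [hγ]; simp)]
  rw [petersson_slash, hγ, hσ]
  simp

theorem petersson_smul_right (f g : ℍ → ℂ) (c : ℂ) (k : ℤ) :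
    petersson k f (c • g) = c • petersson k f g := by
  ext z
  simp only [petersson, Pi.smul_apply, smul_eq_mul]
  ring

theorem peterssonInner_smul_right (V : ℝ) (ℓ : ℕ) (f g : ℍ → ℂ) (c : ℂ) :
    peterssonInner V k ℓ f (c • g) = c * peterssonInner V k ℓ f g := by
  rw [peterssonInner, petersson_smul_right]
  exact integral_const_mul c _

/-- If `G = G₁ G₂`, a cusp form on `G₂` has the same inner products with the cusp forms on `G₁` as
its normalized trace to `G`. -/
theorem exists_trace {V : ℝ} (hV : 0 < V) (hq : q ≠ 0) {G G₁ G₂ : Subgroup (GL (Fin 2) ℝ)}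
    [G.IsArithmetic] [G.HasDetOne] [G₁.IsArithmetic] [G₁.HasDetOne] [G₂.IsArithmetic]
    [G₂.HasDetOne]
    (hG : gamma0 q ≤ G) (hG₁ : gamma0 q ≤ G₁) (hG₂ : gamma0 q ≤ G₂)
    (hfac : ∀ g ∈ G, ∃ g₁ ∈ G₁, ∃ h ∈ G₂, g = g₁ * h) {w : ℍ → ℂ} (hw : IsCuspOn k G₂ w) :
    ∃ t, IsCuspOn k G t ∧ ∀ u, IsCuspOn k G₁ u →
      peterssonInner V k q u t = peterssonInner V k q u w := by
  obtain ⟨W, rfl⟩ := hw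
  have hfr : G₂.IsFiniteRelIndex G := ⟨relIndex_ne_zero_of_isArithmetic _ _⟩
  let _ : Fintype (G ⧸ G₂.subgroupOf G) := Fintype.ofFinite _
  set N := Fintype.card (G ⧸ G₂.subgroupOf G) with hN
  have hN0 : (N : ℂ) ≠ 0 := by
    have : N ≠ 0 := Fintype.card_ne_zero
    exact_mod_cast this
  -- The trace sums W|g⁻¹ over cosets g G₂. Writing g = g₁ h, the factor h⁻¹ fixes W, so every
  -- summand is a slash by an element of G₁.
  have hrep : ∀ c : G ⧸ G₂.subgroupOf G, ∃ r ∈ G₁,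
      SlashInvariantForm.quotientFunc W c = (W : ℍ → ℂ) ∣[(k : ℤ)] r := by
    intro c
    induction c using Quotient.inductionOn with
    | h g =>
      obtain ⟨g₁, h₁, h, h₂, he⟩ := hfac g g.2
      refine ⟨g₁⁻¹, inv_mem h₁, ?_⟩
      rw [SlashInvariantForm.quotientFunc_mk, he, mul_inv_rev, SlashAction.slash_mul,
        SlashInvariantFormClass.slash_action_eq W h⁻¹ (inv_mem h₂)]
  choose r hr hrW using hrep
  refine ⟨(N : ℂ)⁻¹ • (CuspForm.trace G W : CuspForm G (k : ℤ)), IsCuspOn.smul ⟨_, rfl⟩ _,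
    fun u hu => ?_⟩
  have hsum : ((CuspForm.trace G W : CuspForm G (k : ℤ)) : ℍ → ℂ) =
      ∑ c, (W : ℍ → ℂ) ∣[(k : ℤ)] r c := by
    rw [CuspForm.coe_trace]
    exact Finset.sum_congr rfl fun c _ => hrW c
  have hT : ∀ z, petersson k u (CuspForm.trace G W : CuspForm G (k : ℤ)) z =
      ∑ c, petersson k u W (r c • z) := by
    intro z
    rw [hsum]
    -- Since u is invariant under r c, slashing W alone amounts to slashing both functions.
    have h1 : ∀ c, petersson k u W (r c • z) = petersson k u ((W : ℍ → ℂ) ∣[(k : ℤ)] r c) z := by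
      intro c
      rw [← petersson_slash_of_det_eq_one _ _ (Subgroup.HasDetOne.det_eq (hr c))]
      obtain ⟨U, rfl⟩ := hu
      rw [SlashInvariantFormClass.slash_action_eq U _ (hr c)]
    simp_rw [h1]
    simp only [petersson, Finset.sum_apply, Finset.mul_sum, Finset.sum_mul]
  have huq : u ∈ cuspSpace k q := hu.mono hG₁
  have hWq : (W : ℍ → ℂ) ∈ cuspSpace k q := IsCuspOn.mono hG₂ ⟨W, rfl⟩
  have htq : ((CuspForm.trace G W : CuspForm G (k : ℤ)) : ℍ → ℂ) ∈ cuspSpace k q :=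
    IsCuspOn.mono hG ⟨_, rfl⟩
  rw [peterssonInner_smul_right, peterssonInner_eq hV, peterssonInner_eq hV,
    setAverage_sum_smul hq hG₁ (continuous_petersson huq hWq) (exists_petersson_le hq huq hWq)
      (fun γ hγ z => petersson_smul_of_isCuspOn huq hWq hγ z)
      (fun γ hγ z => petersson_smul_of_isCuspOn huq htq hγ z) r hr hT, ← hN]
  field_simp

theorem exists_dvd_add_mul (hp : p.Prime) {x : ℤ} (hx : ¬ (p : ℤ) ∣ x) (B : ℤ) :
    ∃ t : ℤ, (p : ℤ) ∣ B + x * t := by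
  have hp' : Prime (p : ℤ) := Nat.prime_iff_prime_int.1 hp
  obtain ⟨u, v, h⟩ := (hp'.coprime_iff_not_dvd.2 hx)
  exact ⟨-B * v, B * u, by linear_combination -B * h⟩

/-- Right multiplication by the translation by t/p turns the upper right entry into (b + a d
t)/(dp). As p divides `m`, the determinant makes a prime to p; so is `d`, and t can be chosen with p
dividing the numerator. -/
theorem levelGroup_upper_factor (hp : p.Prime) (hd : ¬ p ∣ d) (hpm : p ∣ m) (m₂ : ℕ)
    {g : GL (Fin 2) ℝ} (hg : g ∈ levelGroup (d * p) m) :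
    ∃ g₁ ∈ levelGroup d (p * m), ∃ h ∈ levelGroup p m₂, g = g₁ * h := by
  have hd0 : d ≠ 0 := fun h => hd (by simp [h])
  have hdr : (d : ℝ) ≠ 0 := by exact_mod_cast hd0
  have hpr : (p : ℝ) ≠ 0 := by exact_mod_cast hp.ne_zero
  have hp' : Prime (p : ℤ) := Nat.prime_iff_prime_int.1 hp
  obtain ⟨a, b, c, e, hdet, hg⟩ := (mem_levelGroup (mul_ne_zero hd0 hp.ne_zero)).1 hg
  have ha : ¬ (p : ℤ) ∣ a * d := by
    intro h
    rcases hp'.dvd_or_dvd h with h | h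
    · refine hp'.not_dvd_one (hdet ▸ dvd_sub (h.mul_right _) ?_)
      exact ((Int.natCast_dvd_natCast.2 hpm).mul_left _).mul_left _
    · exact hd (Int.natCast_dvd_natCast.1 h)
  obtain ⟨t, b', hb'⟩ := exists_dvd_add_mul hp ha b
  have hx : affineMap 1 (t / p) ∈ levelGroup p m₂ := by
    refine (mem_levelGroup hp.ne_zero).2 ⟨1, t, 0, 1, by ring, ?_⟩
    rw [affineMap_val _ one_ne_zero]
    simp
  refine ⟨g * affineMap 1 (t / p), ?_, _, inv_mem hx, by group⟩
  refine (mem_levelGroup hd0).2 ⟨a, b', c, e + c * m * d * t, ?_, ?_⟩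
  · push_cast
    linear_combination hdet + c * m * hb'
  · have hb'' : (b : ℝ) + a * d * t = p * b' := by exact_mod_cast hb'
    rw [Units.val_mul, hg, affineMap_val _ one_ne_zero]
    ext i j
    fin_cases i <;> fin_cases j <;> simp [Matrix.mul_apply, Fin.sum_univ_two]
    · field_simp
      linear_combination hb''
    · ring
    · field_simp
      ring

/-- The transposed argument: a lower unipotent factor with entry s d e m turns the lower left entry
into m d (c + δ e s), and p divides neither δ nor `e`. -/
theorem levelGroup_lower_factor (hp : p.Prime) (hd : d ≠ 0) (he : ¬ p ∣ e) (hpm : p ∣ m)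
    {g : GL (Fin 2) ℝ} (hg : g ∈ levelGroup d m) :
    ∃ g₁ ∈ levelGroup d (p * m), ∃ h ∈ levelGroup 1 (d * e * m), g = g₁ * h := by
  have hdr : (d : ℝ) ≠ 0 := by exact_mod_cast hd
  have hp' : Prime (p : ℤ) := Nat.prime_iff_prime_int.1 hp
  obtain ⟨a, b, c, δ, hdet, hg⟩ := (mem_levelGroup hd).1 hg
  have ha : ¬ (p : ℤ) ∣ δ * e := by
    intro h
    rcases hp'.dvd_or_dvd h with h | h
    · refine hp'.not_dvd_one (hdet ▸ dvd_sub (h.mul_left _) ?_)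
      exact ((Int.natCast_dvd_natCast.2 hpm).mul_left _).mul_left _
    · exact he (Int.natCast_dvd_natCast.1 h)
  obtain ⟨s, c', hc'⟩ := exists_dvd_add_mul hp ha c
  set x : GL (Fin 2) ℝ := Matrix.GeneralLinearGroup.mkOfDetNeZero !![1, 0; s * (d * e * m), 1]
    (by simp) with hx
  have hxv : x.val = !![1, 0; (s : ℝ) * (d * e * m), 1] := rfl
  have hx : x ∈ levelGroup 1 (d * e * m) := by
    refine (mem_levelGroup one_ne_zero).2 ⟨1, 0, s, 1, by ring, ?_⟩
    rw [hxv]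
    simp
  refine ⟨g * x, ?_, _, inv_mem hx, by group⟩
  refine (mem_levelGroup hd).2 ⟨a + b * s * e * m, b, c', δ, ?_, ?_⟩
  · push_cast
    linear_combination hdet + b * m * hc'
  · have hc'' : (c : ℝ) + δ * e * s = p * c' := by exact_mod_cast hc'
    rw [Units.val_mul, hg, hxv]
    ext i j
    fin_cases i <;> fin_cases j <;> simp [Matrix.mul_apply, Fin.sum_univ_two]
    · field_simp
    · linear_combination (m : ℝ) * d * hc''

end Trace

/-! ### Growth bounds and absolute convergence. -/

section Growth

variable {k q : ℕ}

/-- Continuous functions `g` such that `g(z) y ^ (k / 2)` is bounded. -/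
def IsModeratelyBounded (k : ℕ) (g : ℍ → ℂ) : Prop :=
  Continuous g ∧ ∃ C : ℝ, ∀ z : ℍ, ‖g z‖ * z.im ^ ((k : ℝ) / 2) ≤ C

theorem IsModeratelyBounded.const_mul {g : ℍ → ℂ} (hg : IsModeratelyBounded k g) (c : ℂ) :
    IsModeratelyBounded k fun z => c * g z := by
  obtain ⟨h1, C, h2⟩ := hg
  refine ⟨continuous_const.mul h1, ‖c‖ * C, fun z => ?_⟩
  rw [norm_mul, mul_assoc]
  exact mul_le_mul_of_nonneg_left (h2 z) (norm_nonneg c)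

theorem IsModeratelyBounded.sum {ι : Type*} (s : Finset ι) {g : ι → ℍ → ℂ}
    (hg : ∀ i ∈ s, IsModeratelyBounded k (g i)) :
    IsModeratelyBounded k fun z => ∑ i ∈ s, g i z := by
  refine ⟨continuous_finsetSum _ fun i hi => (hg i hi).1, ?_⟩
  have h : ∀ i, ∃ C : ℝ, i ∈ s → ∀ z : ℍ, ‖g i z‖ * z.im ^ ((k : ℝ) / 2) ≤ C := fun i => by
    by_cases hi : i ∈ s
    · obtain ⟨C, hC⟩ := (hg i hi).2
      exact ⟨C, fun _ => hC⟩
    · exact ⟨0, fun h => absurd h hi⟩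
  choose C hC using h
  refine ⟨∑ i ∈ s, C i, fun z => ?_⟩
  calc ‖∑ i ∈ s, g i z‖ * z.im ^ ((k : ℝ) / 2)
      ≤ (∑ i ∈ s, ‖g i z‖) * z.im ^ ((k : ℝ) / 2) := by
        gcongr
        exact norm_sum_le _ _
    _ = ∑ i ∈ s, ‖g i z‖ * z.im ^ ((k : ℝ) / 2) := Finset.sum_mul _ _ _
    _ ≤ ∑ i ∈ s, C i := Finset.sum_le_sum fun i hi => hC i hi z

theorem isModeratelyBounded_of_mem_cuspSpace (hq : q ≠ 0) {φ : ℍ → ℂ} (hφ : φ ∈ cuspSpace k q) :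
    IsModeratelyBounded k φ := by
  have := isArithmetic_gamma0 hq
  refine ⟨IsCuspOn.continuous hφ, ?_⟩
  obtain ⟨F, rfl⟩ := hφ
  obtain ⟨C, hC⟩ := CuspFormClass.exists_bound F
  refine ⟨C, fun z => ?_⟩
  have h := hC z
  rw [Int.cast_natCast] at h
  rwa [← le_div_iff₀ (Real.rpow_pos_of_pos z.im_pos _)]

theorem IsModeratelyBounded.comp_affineMap {g : ℍ → ℂ} (hg : IsModeratelyBounded k g)
    {a : ℚ} (ha : 0 < a) (b : ℚ) : IsModeratelyBounded k fun z => g (affineMap a b • z) := by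
  obtain ⟨h1, C, h2⟩ := hg
  have ha' : (0 : ℝ) < a := by exact_mod_cast ha
  refine ⟨h1.comp (continuous_const_smul _), C / (a : ℝ) ^ ((k : ℝ) / 2), fun z => ?_⟩
  have h := h2 (affineMap a b • z)
  rw [im_affineMap_smul _ ha, Real.mul_rpow ha'.le z.im_pos.le] at h
  rw [le_div_iff₀ (by positivity)]
  linarith

theorem hecke_apply (n : ℕ) (φ : ℍ → ℂ) (z : ℍ) :
    hecke k n φ z = (n : ℂ) ^ ((k : ℤ) - 1) * ∑ d ∈ n.divisors, (d : ℂ) ^ (-(k : ℤ)) *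
      ∑ b ∈ Finset.range d, φ (affineMap ((n / d : ℕ) / d) (b / d) • z) := by
  rw [hecke]
  congr 1
  refine Finset.sum_congr rfl fun d hd => ?_
  congr 1
  refine Finset.sum_congr rfl fun b _ => ?_
  congr 1
  have hd0 : 0 < d := Nat.pos_of_mem_divisors hd
  have h1 : 0 < n / d := Nat.div_pos (Nat.divisor_le hd) hd0
  have h2 : (0 : ℚ) < (n / d : ℕ) / d := by positivity
  rw [← ofComplex_affine _ h2]
  congr 1
  push_cast
  ring

theorem hecke_add (n : ℕ) (φ ψ : ℍ → ℂ) : hecke k n (φ + ψ) = hecke k n φ + hecke k n ψ := by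
  ext z
  simp only [hecke, Pi.add_apply, Finset.sum_add_distrib, mul_add]

theorem hecke_smul (n : ℕ) (c : ℂ) (φ : ℍ → ℂ) : hecke k n (c • φ) = c • hecke k n φ := by
  ext z
  simp only [hecke, Pi.smul_apply, smul_eq_mul, ← Finset.mul_sum, mul_left_comm _ c]

/-- The bound passes through each affine substitution, so it holds for T_n φ without modularity of
T_n φ. -/
theorem IsModeratelyBounded.hecke {g : ℍ → ℂ} (hg : IsModeratelyBounded k g) (n : ℕ) :
    IsModeratelyBounded k (hecke k n g) := by
  rw [show NewformIsolation.hecke k n g = _ from funext (hecke_apply n g)]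
  refine .const_mul (.sum _ fun d hd => .const_mul (.sum _ fun b _ => hg.comp_affineMap ?_ _) _) _
  have hd0 : 0 < d := Nat.pos_of_mem_divisors hd
  have h1 : 0 < n / d := Nat.div_pos (Nat.divisor_le hd) hd0
  positivity

theorem norm_petersson_self (f : ℍ → ℂ) (z : ℍ) :
    ‖petersson k f f z‖ = (‖f z‖ * z.im ^ ((k : ℝ) / 2)) ^ 2 := by
  have h : (z.im ^ ((k : ℝ) / 2)) ^ 2 = z.im ^ k := by
    rw [← Real.rpow_natCast, ← Real.rpow_mul z.im_pos.le]
    simp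
  rw [mul_pow, h, petersson]
  rw [zpow_natCast, norm_mul, norm_mul, norm_pow, Complex.norm_real, Complex.norm_conj,
    Real.norm_of_nonneg z.im_pos.le]
  ring

open ConjAct in
/-- A cusp form decays faster than any power of the height at every cusp. -/
theorem exists_decay_bound (hq : q ≠ 0) {φ : ℍ → ℂ} (hφ : φ ∈ cuspSpace k q)
    (g : SL(2, ℤ)) (A : ℝ) :
    ∃ C, ∀ z ∈ 𝒟, ‖φ (g • z)‖ * (g • z).im ^ ((k : ℝ) / 2) * z.im ^ A ≤ C := by
  have := isArithmetic_gamma0 hq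
  obtain ⟨F, rfl⟩ := hφ
  have : ((toConjAct (g : GL (Fin 2) ℝ)⁻¹) • gamma0 q).IsArithmetic := by
    simpa [(show Rat.castHom ℝ = algebraMap ℚ ℝ by rfl), map_inv,
      Matrix.SpecialLinearGroup.map_mapGL]
      using! Subgroup.IsArithmetic.conj (gamma0 q) (Matrix.SpecialLinearGroup.mapGL ℚ g)⁻¹
  obtain ⟨a, ha, hO⟩ := (CuspFormClass.zero_at_infty
    (CuspForm.translate F g)).petersson_exp_decay_left k _ (CuspForm.translate F g)
  -- The exponent is doubled because `petersson` of a function with itself is the square of the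
  -- quantity to be bounded; a square root is taken at the end.
  have hO2 : petersson k (CuspForm.translate F g) (CuspForm.translate F g)
      =O[atImInfty] fun z => z.im ^ (-(2 * A)) := by
    refine hO.trans ?_
    exact (isLittleO_exp_neg_mul_rpow_atTop ha _).isBigO.comp_tendsto Filter.tendsto_comap
  obtain ⟨C, hC⟩ := ModularGroup.exists_bound_fundamental_domain_of_isBigO
    (petersson_continuous _ (CuspFormClass.holo _).continuous (CuspFormClass.holo _).continuous) hO2
  refine ⟨√C, fun z hz => Real.le_sqrt_of_sq_le ?_⟩
  have h := hC z hz
  have h3 : petersson k (CuspForm.translate F g) (CuspForm.translate F g) z =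
      petersson k F F (g • z) := petersson_slash_SL _ _ _ _ _
  rw [h3, norm_petersson_self, Real.rpow_neg z.im_pos.le, ← div_eq_mul_inv,
    le_div_iff₀ (Real.rpow_pos_of_pos z.im_pos _)] at h
  rw [mul_pow]
  refine le_trans (le_of_eq ?_) h
  congr 1
  rw [← Real.rpow_natCast, ← Real.rpow_mul z.im_pos.le, mul_comm A]
  norm_num

/-- Absolute convergence of the integrals of a cusp form against a function of moderate growth and
a moderately bounded function. -/
theorem integrable_petersson_mul (V : ℝ) (hq : q ≠ 0) {φ g Ψ : ℍ → ℂ} (hφ : φ ∈ cuspSpace k q)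
    (hg : IsModeratelyBounded k g) (hΨm : AEMeasurable Ψ (volume : Measure ℍ))
    (hΨ : ModerateGrowth Ψ) :
    Integrable (petersson k φ (Ψ * g)) (levelMeasure V q) := by
  have : NeZero q := ⟨hq⟩
  have : Finite (SL(2, ℤ) ⧸ CongruenceSubgroup.Gamma0 q) :=
    Subgroup.finite_quotient_of_finiteIndex
  by_cases h0 : volume (fundDomain q) = 0
  · rw [levelMeasure, Measure.restrict_eq_zero.2 h0, smul_zero]
    exact integrable_zero_measure
  refine Integrable.smul_measure ?_ (ENNReal.div_ne_top ENNReal.ofReal_ne_top h0)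
  have hmeas : AEStronglyMeasurable (petersson k φ (Ψ * g)) volume := by
    have h1 := (IsCuspOn.continuous hφ).aestronglyMeasurable (μ := volume)
    have h2 : Continuous fun z : ℍ => ((z.im : ℂ)) ^ (k : ℤ) := by
      simp only [zpow_natCast]
      fun_prop
    exact ((Complex.continuous_conj.comp_aestronglyMeasurable h1).mul
      (hΨm.aestronglyMeasurable.mul hg.1.aestronglyMeasurable)).mul h2.aestronglyMeasurable
  change IntegrableOn _ _ _
  rw [fundDomain_eq, integrableOn_finite_iUnion]
  intro c
  set γ := (Quotient.out c)⁻¹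
  rw [integrableOn_smul_set_iff]
  obtain ⟨C, A, hCA⟩ := hΨ
  obtain ⟨C', hC'⟩ := exists_decay_bound hq hφ γ A
  obtain ⟨C'', hC''⟩ := hg.2
  have hmp := measurePreserving_smul (toMob (Matrix.SpecialLinearGroup.mapGL ℝ γ))
    (volume : Measure ℍ)
  refine Measure.integrableOn_of_bounded (M := C' * |C| * C'') volume_fd_lt_top.ne
    (hmeas.comp_measurePreserving hmp) ?_
  refine (ae_restrict_iff' measurableSet_fd).2 (.of_forall fun z hz => ?_)
  have e1 := hCA γ z hz
  have e2 := hC' z hz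
  have e3 := hC'' (γ • z)
  change ‖petersson k φ (Ψ * g) (γ • z)‖ ≤ _
  have hw := (γ • z).im_pos
  have hsplit : ‖petersson k φ (Ψ * g) (γ • z)‖ =
      (‖φ (γ • z)‖ * (γ • z).im ^ ((k : ℝ) / 2)) * ‖Ψ (γ • z)‖ *
        (‖g (γ • z)‖ * (γ • z).im ^ ((k : ℝ) / 2)) := by
    have h : (γ • z).im ^ k = (γ • z).im ^ ((k : ℝ) / 2) * (γ • z).im ^ ((k : ℝ) / 2) := by
      rw [← Real.rpow_add hw, add_halves, Real.rpow_natCast]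
    rw [petersson, zpow_natCast, norm_mul, norm_mul, norm_pow, Complex.norm_real, Complex.norm_conj,
      Real.norm_of_nonneg hw.le, h, Pi.mul_apply, norm_mul]
    ring
  rw [hsplit]
  have hz := Real.rpow_pos_of_pos z.im_pos A
  refine mul_le_mul ?_ e3 (by positivity) ?_
  · calc _ ≤ (‖φ (γ • z)‖ * (γ • z).im ^ ((k : ℝ) / 2)) * (|C| * z.im ^ A) := by
          gcongr
          exact e1.trans (mul_le_mul_of_nonneg_right (le_abs_self C) hz.le)
      _ = (‖φ (γ • z)‖ * (γ • z).im ^ ((k : ℝ) / 2) * z.im ^ A) * |C| := by ring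
      _ ≤ _ := by gcongr
  · refine mul_nonneg (le_trans (by positivity) e2) (abs_nonneg C)

end Growth

/-! ### Diagonal sums of sesquilinear forms. -/

section Sesquilinear

variable {X : Type*} [AddCommGroup X] [Module ℂ X] {I J : Type*} [Fintype I] [Fintype J]

/-- The operator `x ↦ ∑ ⟨w j, x⟩ w j` of a finite family of vectors. -/
def projection (H : X →ₗ⋆[ℂ] X →ₗ[ℂ] ℂ) (w : J → X) : X →ₗ[ℂ] X :=
  ∑ j, (H (w j)).smulRight (w j)

theorem projection_apply (H : X →ₗ⋆[ℂ] X →ₗ[ℂ] ℂ) (w : J → X) (x : X) :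
    projection H w x = ∑ j, H (w j) x • w j := by
  simp [projection]

theorem projection_symm {H : X →ₗ⋆[ℂ] X →ₗ[ℂ] ℂ} (hH : ∀ x y, starRingEnd ℂ (H x y) = H y x)
    (w : J → X) (x y : X) : H (projection H w x) y = H x (projection H w y) := by
  simp only [projection_apply, map_sum, LinearMap.sum_apply, map_smul, map_smulₛₗ,
    LinearMap.smul_apply, smul_eq_mul, hH]
  exact Finset.sum_congr rfl fun j _ => mul_comm _ _

/-- A trace formula: diagonal sums of a sesquilinear form over a finite family depend only on the
projection operator of the family. -/
theorem sum_diagonal_eq {H : X →ₗ⋆[ℂ] X →ₗ[ℂ] ℂ} (hH : ∀ x y, starRingEnd ℂ (H x y) = H y x)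
    (S : X →ₗ⋆[ℂ] X →ₗ[ℂ] ℂ) {v : I → X} (hv : ∀ x, projection H v x = x) (w : J → X) :
    ∑ j, S (w j) (w j) = ∑ i, S (v i) (projection H w (v i)) := by
  -- Expand only the first argument in the family `v`; the conjugate-linearity of `S` there turns ⟨v
  -- i, w j⟩ into ⟨w j, v i⟩.
  have h1 : ∀ j, S (w j) (w j) = ∑ i, H (w j) (v i) * S (v i) (w j) := by
    intro j
    calc S (w j) (w j) = S (projection H v (w j)) (w j) := by rw [hv]
      _ = _ := by
        simp only [projection_apply, map_sum, LinearMap.sum_apply, map_smulₛₗ,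
          LinearMap.smul_apply, smul_eq_mul, hH]
  simp_rw [h1, projection_apply, map_sum, map_smul, smul_eq_mul]
  exact Finset.sum_comm

end Sesquilinear

/-! ### Petersson products as sesquilinear forms, and orthonormal expansions. -/

section Forms

variable {k q : ℕ}

/-- The sesquilinear form `(f, g) ↦ ⟨f, L g⟩` on cusp forms. -/
def innerForm (V : ℝ) (k q : ℕ) (L : cuspSpace k q →ₗ[ℂ] (ℍ → ℂ))
    (hL : ∀ f g : cuspSpace k q, Integrable (petersson k f (L g)) (levelMeasure V q)) :
    cuspSpace k q →ₗ⋆[ℂ] cuspSpace k q →ₗ[ℂ] ℂ :=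
  LinearMap.mk₂'ₛₗ (starRingEnd ℂ) (RingHom.id ℂ) (fun f g => peterssonInner V k q f (L g))
    (fun f₁ f₂ g => by
      rw [peterssonInner, peterssonInner, peterssonInner, ← integral_add (hL f₁ g) (hL f₂ g)]
      congr 1; ext z
      simp only [petersson, Submodule.coe_add, Pi.add_apply, map_add]; ring)
    (fun c f g => by
      rw [peterssonInner, peterssonInner, smul_eq_mul, ← integral_const_mul]
      congr 1; ext z
      simp only [petersson, Submodule.coe_smul, Pi.smul_apply, smul_eq_mul, map_mul]; ring)
    (fun f g₁ g₂ => by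
      rw [peterssonInner, peterssonInner, peterssonInner, ← integral_add (hL f g₁) (hL f g₂)]
      congr 1; ext z
      simp only [petersson, map_add, Pi.add_apply]; ring)
    (fun c f g => by
      rw [map_smul, peterssonInner_smul_right, RingHom.id_apply, smul_eq_mul])

theorem peterssonInner_conj (V : ℝ) (f g : ℍ → ℂ) :
    starRingEnd ℂ (peterssonInner V k q f g) = peterssonInner V k q g f := by
  rw [peterssonInner, peterssonInner, ← integral_conj]
  simp only [← petersson_symm]

theorem peterssonInner_sum_smul (V : ℝ) (hq : q ≠ 0) {f : ℍ → ℂ} (hf : f ∈ cuspSpace k q)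
    {ι : Type*} (s : Finset ι) (c : ι → ℂ) {g : ι → ℍ → ℂ} (hg : ∀ i ∈ s, g i ∈ cuspSpace k q) :
    peterssonInner V k q f (∑ i ∈ s, c i • g i) = ∑ i ∈ s, c i * peterssonInner V k q f (g i) := by
  rw [peterssonInner]
  have h : petersson k f (∑ i ∈ s, c i • g i) = fun z => ∑ i ∈ s, c i * petersson k f (g i) z := by
    ext z
    simp only [petersson, Finset.sum_apply, Pi.smul_apply, smul_eq_mul, Finset.mul_sum,
      Finset.sum_mul]
    exact Finset.sum_congr rfl fun i _ => by ring
  rw [h, integral_finsetSum _ fun i hi => (integrable_petersson V hq hf (hg i hi)).const_mul _]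
  exact Finset.sum_congr rfl fun i _ => integral_const_mul _ _

theorem IsOrthonormalBasis.mem {V : ℝ} {W : Set (ℍ → ℂ)} {B : Finset (ℍ → ℂ)}
    (hB : IsOrthonormalBasis V k q W B) {φ : ℍ → ℂ} (hφ : φ ∈ B) : φ ∈ W :=
  hB.span_eq ▸ Submodule.subset_span hφ

theorem IsOrthonormalBasis.expansion {V : ℝ} (hq : q ≠ 0) {W : Set (ℍ → ℂ)} {B : Finset (ℍ → ℂ)}
    (hB : IsOrthonormalBasis V k q W B) (hW : W ⊆ cuspSpace k q) {f : ℍ → ℂ} (hf : f ∈ W) :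
    ∑ φ ∈ B, peterssonInner V k q φ f • φ = f := by
  classical
  have hf' : f ∈ Submodule.span ℂ (B : Set (ℍ → ℂ)) := by
    rw [← SetLike.mem_coe, hB.span_eq]; exact hf
  obtain ⟨c, -, rfl⟩ := Submodule.mem_span_finset.1 hf'
  refine Finset.sum_congr rfl fun ψ hψ => ?_
  rw [peterssonInner_sum_smul V hq (hW (hB.mem hψ)) _ _ fun φ hφ => hW (hB.mem hφ),
    Finset.sum_eq_single_of_mem ψ hψ, hB.norm_one ψ hψ, mul_one]
  intro φ hφ hne
  rw [hB.orthogonal ψ hψ φ hφ hne.symm, mul_zero]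

end Forms

/-! ### Möbius cancellation and divisibility from the cube condition. -/

section Arithmetic

variable {q : ℕ}

/-- On squarefree divisors, multiplying or dividing by p is an involution that flips the sign of μ
and preserves `a`. -/
theorem sum_moebius_smul_eq_zero {X : Type*} [AddCommGroup X] [Module ℂ X] {p : ℕ} (hp : p.Prime)
    (hpq : p ∣ q) (hq : q ≠ 0) (a : ℕ → X)
    (ha : ∀ d, d ∣ q → Squarefree d → ¬ p ∣ d → a (d * p) = a d) :
    ∑ d ∈ q.divisors, (ArithmeticFunction.moebius d : ℂ) • a d = 0 := by
  classical
  have h0 : ∀ d ∈ q.divisors, (ArithmeticFunction.moebius d : ℂ) • a d ≠ 0 → Squarefree d := by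
    intro d _ h
    by_contra hs
    exact h (by simp [ArithmeticFunction.moebius_eq_zero_of_not_squarefree hs])
  rw [← Finset.sum_filter_of_ne h0]
  have hmul : ∀ d, d ∣ q → Squarefree d → ¬ p ∣ d →
      (ArithmeticFunction.moebius (d * p) : ℂ) • a (d * p) =
        -((ArithmeticFunction.moebius d : ℂ) • a d) := by
    intro d hd hs hpd
    rw [ArithmeticFunction.isMultiplicative_moebius.map_mul_of_coprime
      ((Nat.Prime.coprime_iff_not_dvd hp).2 hpd).symm, ArithmeticFunction.moebius_apply_prime hp,
      ha d hd hs hpd]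
    simp
  have hdiv : ∀ d, Squarefree d → p ∣ d → d / p * p = d ∧ Squarefree (d / p) ∧ ¬ p ∣ d / p := by
    rintro _ hs ⟨d, rfl⟩
    rw [Nat.mul_div_cancel_left _ hp.pos]
    refine ⟨mul_comm _ _, hs.of_mul_right, ?_⟩
    rintro ⟨x, rfl⟩
    exact hp.one_lt.ne' (Nat.isUnit_iff.1 (hs p ⟨x, by ring⟩))
  refine Finset.sum_involution (fun d _ => if p ∣ d then d / p else d * p) ?_ ?_ ?_ ?_
  · intro d hd
    obtain ⟨hd, hs⟩ := Finset.mem_filter.1 hd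
    have hdq := Nat.dvd_of_mem_divisors hd
    split_ifs with h
    · obtain ⟨h1, h2, h3⟩ := hdiv d hs h
      have := hmul (d / p) ((Dvd.intro _ h1).trans hdq) h2 h3
      rw [h1] at this
      rw [this, neg_add_cancel]
    · rw [hmul d hdq hs h, add_neg_cancel]
  · intro d hd _
    obtain ⟨hd, hs⟩ := Finset.mem_filter.1 hd
    have hd0 := Nat.pos_of_mem_divisors hd
    split_ifs with h
    · exact (Nat.div_lt_self hd0 hp.one_lt).ne
    · exact (lt_mul_of_one_lt_right hd0 hp.one_lt).ne'
  · intro d hd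
    obtain ⟨hd, hs⟩ := Finset.mem_filter.1 hd
    have hdq := Nat.dvd_of_mem_divisors hd
    split_ifs with h
    · obtain ⟨h1, h2, h3⟩ := hdiv d hs h
      exact Finset.mem_filter.2 ⟨Nat.mem_divisors.2 ⟨(Dvd.intro _ h1).trans hdq, hq⟩, h2⟩
    · have hc := ((Nat.Prime.coprime_iff_not_dvd hp).2 h).symm
      exact Finset.mem_filter.2 ⟨Nat.mem_divisors.2 ⟨hc.mul_dvd_of_dvd_of_dvd hdq hpq, hq⟩,
        (Nat.squarefree_mul hc).2 ⟨hs, hp.prime.squarefree⟩⟩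
  · intro d hd
    obtain ⟨hd, hs⟩ := Finset.mem_filter.1 hd
    by_cases h : p ∣ d
    · obtain ⟨h1, h2, h3⟩ := hdiv d hs h
      simp [h, h3, h1]
    · simp [h, Nat.mul_div_cancel _ hp.pos]

/-- At each prime the three squarefree factors contribute at most 1 + 1 + 1 = 3 to the valuation.
This is where the cube condition is used. -/
theorem mul_mul_prime_dvd (hcube : ∀ p : ℕ, p.Prime → p ∣ q → p ^ 3 ∣ q) (hq : q ≠ 0)
    {d e p : ℕ} (hd : Squarefree d) (he : Squarefree e) (hdq : d ∣ q) (heq : e ∣ q) (hp : p.Prime)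
    (hpq : p ∣ q) : d * e * p ∣ q := by
  have hd0 := hd.ne_zero
  have he0 := he.ne_zero
  rw [← Nat.factorization_prime_le_iff_dvd (mul_ne_zero (mul_ne_zero hd0 he0) hp.ne_zero) hq]
  intro r hr
  rw [Nat.factorization_mul (mul_ne_zero hd0 he0) hp.ne_zero, Nat.factorization_mul hd0 he0]
  simp only [Finsupp.add_apply]
  by_cases h : r ∣ q
  · have h1 := hd.natFactorization_le_one r
    have h2 := he.natFactorization_le_one r
    have h3 := hp.prime.squarefree.natFactorization_le_one r
    have h4 := (hr.pow_dvd_iff_le_factorization hq).1 (hcube r hr h)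
    omega
  · rw [Nat.factorization_eq_zero_of_not_dvd fun h' => h (h'.trans hdq),
      Nat.factorization_eq_zero_of_not_dvd fun h' => h (h'.trans heq),
      Nat.factorization_eq_zero_of_not_dvd fun h' => h (h'.trans hpq)]
    simp

theorem mul_dvd_of_squarefree (hcube : ∀ p : ℕ, p.Prime → p ∣ q → p ^ 3 ∣ q) (hq : q ≠ 0)
    {d e : ℕ} (hd : Squarefree d) (he : Squarefree e) (hdq : d ∣ q) (heq : e ∣ q) :
    d * e ∣ q := by
  by_cases h1 : q = 1
  · subst h1
    rw [Nat.dvd_one.1 hdq, Nat.dvd_one.1 heq]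
  · obtain ⟨p, hp, hpq⟩ := Nat.exists_prime_and_dvd h1
    exact (Dvd.intro _ rfl).trans (mul_mul_prime_dvd hcube hq hd he hdq heq hp hpq)

end Arithmetic

/-! ### The alternating sum of projections is the projection to the newspace. -/

section Isolation

variable {k q : ℕ} {V : ℝ}

/-- The Petersson inner product of level `q` as a sesquilinear form on the cusp forms. -/
def cuspInner (V : ℝ) (k : ℕ) {q : ℕ} (hq : q ≠ 0) :
    cuspSpace k q →ₗ⋆[ℂ] cuspSpace k q →ₗ[ℂ] ℂ :=
  innerForm V k q (cuspSpace k q).subtype fun f g => integrable_petersson V hq f.2 g.2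

theorem cuspInner_apply (hq : q ≠ 0) (f g : cuspSpace k q) :
    cuspInner V k hq f g = peterssonInner V k q f g := rfl

theorem cuspInner_conj (hq : q ≠ 0) (f g : cuspSpace k q) :
    starRingEnd ℂ (cuspInner V k hq f g) = cuspInner V k hq g f :=
  peterssonInner_conj V _ _

open Classical in
/-- The functions `φ|_d`, for `φ` in `B`, as elements of the space of cusp forms of level `q`. -/
def raisedFamily (k q d : ℕ) (B : Finset (ℍ → ℂ)) (φ : B) : cuspSpace k q :=
  -- The default 0 allows a definition for all `d` and `B`; it is not taken when `d * m ∣ q`, `d ≠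
  -- 0` and `B` is a basis of A(m).
  if h : raise k d φ ∈ cuspSpace k q then ⟨raise k d φ, h⟩ else 0

theorem coe_raisedFamily {d m : ℕ} (hd : d ≠ 0) (h : d * m ∣ q) {B : Finset (ℍ → ℂ)}
    (hB : IsOrthonormalBasis V k m (cuspSpace k m) B) (φ : B) :
    (raisedFamily k q d B φ : ℍ → ℂ) = raise k d φ := by
  rw [raisedFamily, dif_pos (raise_mem_cuspSpace hd h (hB.mem φ.2))]

/-- The projection attached to a raised orthonormal basis is the identity on the raised space. -/
theorem projection_raisedFamily_of_isCuspOn (hV : 0 < V) (hq : q ≠ 0) {d m : ℕ} (hd : d ≠ 0)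
    (h : d * m ∣ q) {B : Finset (ℍ → ℂ)} (hB : IsOrthonormalBasis V k m (cuspSpace k m) B)
    {x : cuspSpace k q} (hx : IsCuspOn k (levelGroup d m) (x : ℍ → ℂ)) :
    projection (cuspInner V k hq) (raisedFamily k q d B) x = x := by
  have hm : m ≠ 0 := fun h0 => hq (by simpa [h0] using h)
  obtain ⟨φ, hφ, hxφ⟩ := (isCuspOn_levelGroup_iff hd).1 hx
  apply Subtype.ext
  rw [projection_apply, AddSubmonoidClass.coe_finsetSum]
  simp only [Submodule.coe_smul, cuspInner_apply, coe_raisedFamily hd h hB, hxφ]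
  conv_rhs => rw [← hB.expansion hm subset_rfl hφ, ← Finset.sum_coe_sort]
  change _ = raiseHom k d _
  rw [map_sum]
  refine Finset.sum_congr rfl fun ψ _ => ?_
  rw [map_smul, peterssonInner_raise hV hd hq h (hB.mem ψ.2) hφ]
  rfl

theorem isCuspOn_raisedFamily {d m : ℕ} (hd : d ≠ 0)
    (h : d * m ∣ q) {B : Finset (ℍ → ℂ)} (hB : IsOrthonormalBasis V k m (cuspSpace k m) B) (φ : B) :
    IsCuspOn k (levelGroup d m) (raisedFamily k q d B φ : ℍ → ℂ) :=
  (isCuspOn_levelGroup_iff hd).2 ⟨φ, hB.mem φ.2, coe_raisedFamily hd h hB φ⟩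

/-- If the forms on `G₂` have traces to the group `levelGroup d' m'`, then the projections of such
a form to the two raised spaces agree. -/
theorem projection_eq_of_factor (hV : 0 < V) (hq : q ≠ 0) {d m d' m' d₂ m₂ : ℕ}
    (hd : d ≠ 0) (hd' : d' ≠ 0) (hd₂ : d₂ ≠ 0)
    (h : d * m ∣ q) (h' : d' * m' ∣ q) (h₂ : d₂ * m₂ ∣ q)
    (hle : levelGroup d m ≤ levelGroup d' m')
    (hfac : ∀ g ∈ levelGroup d' m', ∃ g₁ ∈ levelGroup d m, ∃ x ∈ levelGroup d₂ m₂, g = g₁ * x)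
    {B B' : Finset (ℍ → ℂ)} (hB : IsOrthonormalBasis V k m (cuspSpace k m) B)
    (hB' : IsOrthonormalBasis V k m' (cuspSpace k m') B')
    {w : cuspSpace k q} (hw : IsCuspOn k (levelGroup d₂ m₂) (w : ℍ → ℂ)) :
    projection (cuspInner V k hq) (raisedFamily k q d' B') w =
      projection (cuspInner V k hq) (raisedFamily k q d B) w := by
  have hm : m ≠ 0 := fun h0 => hq (by simpa [h0] using h)
  have hm' : m' ≠ 0 := fun h0 => hq (by simpa [h0] using h')
  have hm₂ : m₂ ≠ 0 := fun h0 => hq (by simpa [h0] using h₂)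
  have := isArithmetic_levelGroup d hm
  have := isArithmetic_levelGroup d' hm'
  have := isArithmetic_levelGroup d₂ hm₂
  obtain ⟨t, ht, hut⟩ := exists_trace hV hq (gamma0_le_levelGroup hd' h')
    (gamma0_le_levelGroup hd h) (gamma0_le_levelGroup hd₂ h₂) hfac hw
  set T : cuspSpace k q := ⟨t, ht.mono (gamma0_le_levelGroup hd' h')⟩ with hT
  have h1 : ∀ u : cuspSpace k q, IsCuspOn k (levelGroup d m) (u : ℍ → ℂ) →
      cuspInner V k hq u w = cuspInner V k hq u T := fun u hu => (hut u hu).symm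
  -- `T` is a form on both groups, hence fixed by both projections, and its coefficients against
  -- either family are those of w.
  have e1 : projection (cuspInner V k hq) (raisedFamily k q d B) w = T := by
    rw [← projection_raisedFamily_of_isCuspOn hV hq hd h hB (x := T) (ht.mono hle)]
    simp only [projection_apply]
    exact Finset.sum_congr rfl fun φ _ => by rw [h1 _ (isCuspOn_raisedFamily hd h hB φ)]
  have e2 : projection (cuspInner V k hq) (raisedFamily k q d' B') w = T := by
    rw [← projection_raisedFamily_of_isCuspOn hV hq hd' h' hB' (x := T) ht]
    simp only [projection_apply]
    exact Finset.sum_congr rfl fun φ _ => by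
      rw [h1 _ ((isCuspOn_raisedFamily hd' h' hB' φ).mono hle)]
  rw [e1, e2]

/-- The alternating sum of the projections to the raised spaces. -/
def isolator (V : ℝ) (k : ℕ) {q : ℕ} (hq : q ≠ 0) (B : ℕ → Finset (ℍ → ℂ)) :
    cuspSpace k q →ₗ[ℂ] cuspSpace k q :=
  ∑ d ∈ q.divisors, (ArithmeticFunction.moebius d : ℂ) • ∑ e ∈ q.divisors,
    (ArithmeticFunction.moebius e : ℂ) •
      projection (cuspInner V k hq) (raisedFamily k q d (B (q / (d * e))))

theorem isolator_apply (hq : q ≠ 0) (B : ℕ → Finset (ℍ → ℂ)) (x : cuspSpace k q) :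
    isolator V k hq B x = ∑ d ∈ q.divisors, (ArithmeticFunction.moebius d : ℂ) •
      ∑ e ∈ q.divisors, (ArithmeticFunction.moebius e : ℂ) •
        projection (cuspInner V k hq) (raisedFamily k q d (B (q / (d * e)))) x := by
  simp [isolator]

/-- Each projection is self-adjoint and the coefficients μ(d) μ(e) are real. -/
theorem isolator_symm (hq : q ≠ 0) (B : ℕ → Finset (ℍ → ℂ)) (x y : cuspSpace k q) :
    cuspInner V k hq (isolator V k hq B x) y = cuspInner V k hq x (isolator V k hq B y) := by
  simp only [isolator_apply, map_sum, map_smul, map_smulₛₗ, LinearMap.sum_apply,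
    LinearMap.smul_apply, projection_symm (cuspInner_conj hq), map_intCast]

variable (hcube : ∀ p : ℕ, p.Prime → p ∣ q → p ^ 3 ∣ q) {B : ℕ → Finset (ℍ → ℂ)}
  (hB : ∀ ℓ : ℕ, ℓ ∣ q → IsOrthonormalBasis V k ℓ (cuspSpace k ℓ : Set (ℍ → ℂ)) (B ℓ))

theorem moebius_smul_congr {X : Type*} [AddCommGroup X] [Module ℂ X] {d : ℕ} {x y : X}
    (h : Squarefree d → x = y) :
    (ArithmeticFunction.moebius d : ℂ) • x = (ArithmeticFunction.moebius d : ℂ) • y := by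
  by_cases hd : Squarefree d
  · rw [h hd]
  · simp [ArithmeticFunction.moebius_eq_zero_of_not_squarefree hd]

include hcube hB

theorem isolator_eq_zero_of_raise (hV : 0 < V) (hq : q ≠ 0) {p : ℕ} (hp : p.Prime) (hpq : p ∣ q)
    {w : cuspSpace k q} (hw : IsCuspOn k (levelGroup p (q / p)) (w : ℍ → ℂ)) :
    isolator V k hq B w = 0 := by
  rw [isolator_apply]
  refine sum_moebius_smul_eq_zero (X := cuspSpace k q) hp hpq hq _ fun d hd hds hpd => ?_
  refine Finset.sum_congr rfl fun e he => moebius_smul_congr (X := cuspSpace k q) fun hes => ?_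
  have heq := Nat.dvd_of_mem_divisors he
  have hc := ((Nat.Prime.coprime_iff_not_dvd hp).2 hpd).symm
  -- Applied to dp, e and one more p: the level q/(dpe) = pm keeps the factor p required by
  -- `levelGroup_upper_factor`.
  obtain ⟨m, hm⟩ := mul_mul_prime_dvd hcube hq
    ((Nat.squarefree_mul hc).2 ⟨hds, hp.prime.squarefree⟩) hes
    (hc.mul_dvd_of_dvd_of_dvd hd hpq) heq hp hpq
  have hd0 := hds.ne_zero
  have he0 := hes.ne_zero
  have hm1 : q / (d * p * e) = p * m := Nat.div_eq_of_eq_mul_right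
    (Nat.pos_of_ne_zero (mul_ne_zero (mul_ne_zero hd0 hp.ne_zero) he0)) (by rw [hm]; ring)
  have hm2 : q / (d * e) = p * (p * m) := Nat.div_eq_of_eq_mul_right
    (Nat.pos_of_ne_zero (mul_ne_zero hd0 he0)) (by rw [hm]; ring)
  rw [hm1, hm2]
  exact projection_eq_of_factor hV hq hd0 (mul_ne_zero hd0 hp.ne_zero) hp.ne_zero
    ⟨e, by rw [hm]; ring⟩ ⟨e, by rw [hm]; ring⟩ (Nat.mul_div_cancel' hpq).dvd
    (levelGroup_mono (mul_ne_zero hd0 hp.ne_zero) ⟨p, rfl⟩ ⟨1, by ring⟩)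
    (fun g hg => levelGroup_upper_factor hp hpd ⟨m, rfl⟩ _ hg)
    (hB _ ⟨d * e, by rw [hm]; ring⟩) (hB _ ⟨d * e * p, by rw [hm]; ring⟩) hw

theorem isolator_eq_zero_of_lower (hV : 0 < V) (hq : q ≠ 0) {p : ℕ} (hp : p.Prime) (hpq : p ∣ q)
    {w : cuspSpace k q} (hw : IsCuspOn k (levelGroup 1 (q / p)) (w : ℍ → ℂ)) :
    isolator V k hq B w = 0 := by
  rw [isolator_apply]
  refine Finset.sum_eq_zero fun d hd => ?_
  by_cases hds : Squarefree d
  swap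
  · simp [ArithmeticFunction.moebius_eq_zero_of_not_squarefree hds]
  have hdq := Nat.dvd_of_mem_divisors hd
  rw [sum_moebius_smul_eq_zero (X := cuspSpace k q) hp hpq hq _ fun e heq hes hpe => ?_, smul_zero]
  have hc := ((Nat.Prime.coprime_iff_not_dvd hp).2 hpe).symm
  -- Here the spare p accompanies d and ep, so that q/(dep) = pm as `levelGroup_lower_factor`
  -- requires.
  obtain ⟨m, hm⟩ := mul_mul_prime_dvd hcube hq hds
    ((Nat.squarefree_mul hc).2 ⟨hes, hp.prime.squarefree⟩)
    hdq (hc.mul_dvd_of_dvd_of_dvd heq hpq) hp hpq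
  have hd0 := hds.ne_zero
  have he0 := hes.ne_zero
  have hm1 : q / (d * (e * p)) = p * m := Nat.div_eq_of_eq_mul_right
    (Nat.pos_of_ne_zero (mul_ne_zero hd0 (mul_ne_zero he0 hp.ne_zero))) (by rw [hm]; ring)
  have hm2 : q / (d * e) = p * (p * m) := Nat.div_eq_of_eq_mul_right
    (Nat.pos_of_ne_zero (mul_ne_zero hd0 he0)) (by rw [hm]; ring)
  have hm3 : q / p = d * e * (p * m) := Nat.div_eq_of_eq_mul_right hp.pos (by rw [hm]; ring)
  rw [hm1, hm2]
  rw [hm3] at hw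
  exact projection_eq_of_factor hV hq hd0 hd0 one_ne_zero
    ⟨e, by rw [hm]; ring⟩ ⟨e * p, by rw [hm]; ring⟩ ⟨p, by rw [hm]; ring⟩
    (levelGroup_mono hd0 dvd_rfl ⟨p, by ring⟩)
    (fun g hg => levelGroup_lower_factor hp hd0 hpe ⟨m, rfl⟩ hg)
    (hB _ ⟨d * e, by rw [hm]; ring⟩) (hB _ ⟨d * e * p, by rw [hm]; ring⟩) hw

/-- By self-adjointness it suffices that the isolator kills each generator φ|_d of the oldspace. If
d = 1, then φ has level q/p for some prime p; if p divides d, then φ|_d is the raise by p of a form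
of level q/p. -/
theorem isolator_mem_newspace (hV : 0 < V) (hq : q ≠ 0) (x : cuspSpace k q) :
    (isolator V k hq B x : ℍ → ℂ) ∈ newspace V k q := by
  refine ⟨(isolator V k hq B x).2, fun g hg => ?_⟩
  suffices h : ∃ h : g ∈ cuspSpace k q, cuspInner V k hq ⟨g, h⟩ (isolator V k hq B x) = 0 from h.2
  induction hg using Submodule.span_induction with
  | zero => exact ⟨zero_mem _, by rw [cuspInner_apply]; simp [peterssonInner, petersson]⟩
  | add f g _ _ hf hg =>
    obtain ⟨hf, hf0⟩ := hf
    obtain ⟨hg, hg0⟩ := hg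
    refine ⟨add_mem hf hg, ?_⟩
    have : (⟨f + g, add_mem hf hg⟩ : cuspSpace k q) = ⟨f, hf⟩ + ⟨g, hg⟩ := rfl
    rw [this, map_add, LinearMap.add_apply, hf0, hg0, add_zero]
  | smul c f _ hf =>
    obtain ⟨hf, hf0⟩ := hf
    refine ⟨Submodule.smul_mem _ c hf, ?_⟩
    have : (⟨c • f, Submodule.smul_mem _ c hf⟩ : cuspSpace k q) = c • ⟨f, hf⟩ := rfl
    rw [this, map_smulₛₗ, LinearMap.smul_apply, hf0, smul_zero]
  | mem g hg =>
    obtain ⟨ℓ, d, hℓq, hne, hd, φ, hφ, rfl⟩ := hg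
    obtain ⟨r, rfl⟩ := hℓq
    have hℓ0 : ℓ ≠ 0 := fun h => hq (by simp [h])
    rw [Nat.mul_div_cancel_left _ (Nat.pos_of_ne_zero hℓ0)] at hd
    obtain ⟨s, rfl⟩ := hd
    have hd0 : d ≠ 0 := fun h => hq (by simp [h])
    have hmem : raise k d φ ∈ cuspSpace k (ℓ * (d * s)) :=
      raise_mem_cuspSpace hd0 ⟨s, by ring⟩ hφ
    refine ⟨hmem, ?_⟩
    rw [← isolator_symm]
    suffices h : isolator V k hq B ⟨raise k d φ, hmem⟩ = 0 by
      rw [h, map_zero, LinearMap.zero_apply]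
    by_cases hd1 : d = 1
    · subst hd1
      have hs1 : s ≠ 1 := fun h => hne (by simp [h])
      obtain ⟨p, hp, t, rfl⟩ := Nat.exists_prime_and_dvd hs1
      refine isolator_eq_zero_of_lower hcube hB hV hq hp ⟨ℓ * t, by ring⟩ ?_
      have hdiv : ℓ * (1 * (p * t)) / p = ℓ * t :=
        Nat.div_eq_of_eq_mul_right hp.pos (by ring)
      rw [hdiv]
      refine (isCuspOn_levelGroup_iff one_ne_zero).2 ⟨φ, ?_, rfl⟩
      have := raise_mem_cuspSpace (k := k) (q := ℓ * t) one_ne_zero ⟨t, by ring⟩ hφ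
      rwa [raise_one] at this
    · obtain ⟨p, hp, d, rfl⟩ := Nat.exists_prime_and_dvd hd1
      have hd0' : d ≠ 0 := fun h => hd0 (by simp [h])
      refine isolator_eq_zero_of_raise hcube hB hV hq hp ⟨ℓ * (d * s), by ring⟩ ?_
      have hdiv : ℓ * (p * d * s) / p = ℓ * (d * s) :=
        Nat.div_eq_of_eq_mul_right hp.pos (by ring)
      rw [hdiv]
      exact (isCuspOn_levelGroup_iff hp.ne_zero).2 ⟨raise k d φ,
        raise_mem_cuspSpace hd0' ⟨s, by ring⟩ hφ, (raise_raise hp.ne_zero hd0' φ).symm⟩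

/-- For de ≠ 1 the raised family lies in the oldspace, so all its coefficients against x vanish. -/
theorem isolator_of_mem_newspace (hV : 0 < V) (hq : q ≠ 0) {x : cuspSpace k q}
    (hx : (x : ℍ → ℂ) ∈ newspace V k q) : isolator V k hq B x = x := by
  have hz : ∀ d ∈ q.divisors, ∀ e ∈ q.divisors, Squarefree d → Squarefree e → d * e ≠ 1 →
      projection (cuspInner V k hq) (raisedFamily k q d (B (q / (d * e)))) x = 0 := by
    intro d hd e he hds hes hne
    obtain ⟨m, hm⟩ := mul_dvd_of_squarefree hcube hq hds hes (Nat.dvd_of_mem_divisors hd)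
      (Nat.dvd_of_mem_divisors he)
    have hde : 0 < d * e := Nat.pos_of_ne_zero (mul_ne_zero hds.ne_zero hes.ne_zero)
    have hm0 : m ≠ 0 := fun h => hq (by simpa [h] using hm)
    have hm1 : q / (d * e) = m := Nat.div_eq_of_eq_mul_right hde hm
    have hBm := hB m ⟨d * e, by rw [hm]; ring⟩
    rw [projection_apply, hm1]
    refine Finset.sum_eq_zero fun φ _ => ?_
    rw [cuspInner_apply, coe_raisedFamily hds.ne_zero ⟨e, by rw [hm]; ring⟩ hBm, hx.2, zero_smul]
    refine Submodule.subset_span ⟨m, d, ⟨d * e, by rw [hm]; ring⟩, ?_, ?_, φ, hBm.mem φ.2, rfl⟩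
    · intro h
      exact hne (Nat.eq_of_mul_eq_mul_right (Nat.pos_of_ne_zero hm0) (by rw [← hm, ← h, one_mul]))
    · rw [hm, Nat.mul_div_cancel _ (Nat.pos_of_ne_zero hm0)]
      exact ⟨e, rfl⟩
  have h1q : 1 ∈ q.divisors := Nat.mem_divisors.2 ⟨one_dvd q, hq⟩
  rw [isolator_apply, Finset.sum_eq_single_of_mem 1 h1q, Finset.sum_eq_single_of_mem 1 h1q]
  · simp only [ArithmeticFunction.moebius_apply_one, Int.cast_one, one_smul]
    rw [mul_one, Nat.div_one]
    exact projection_raisedFamily_of_isCuspOn hV hq one_ne_zero (by simp) (hB q dvd_rfl)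
      (by rw [levelGroup_one]; exact x.2)
  · intro e he hne
    rw [← smul_zero (ArithmeticFunction.moebius e : ℂ)]
    exact moebius_smul_congr (X := cuspSpace k q) fun hes => hz 1 h1q e he squarefree_one hes (by simpa using hne)
  · intro d hd hne
    rw [← smul_zero (ArithmeticFunction.moebius d : ℂ)]
    refine moebius_smul_congr (X := cuspSpace k q) fun hds => Finset.sum_eq_zero fun e he => ?_
    rw [← smul_zero (ArithmeticFunction.moebius e : ℂ)]
    exact moebius_smul_congr (X := cuspSpace k q) fun hes => hz d hd e he hds hes
      fun h => hne (Nat.eq_one_of_mul_eq_one_right h)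

/-- The alternating sum of projections is the projection to the newspace. -/
theorem projection_newspace_eq (hV : 0 < V) (hq : q ≠ 0) {Bnew : Finset (ℍ → ℂ)}
    (hBnew : IsOrthonormalBasis V k q (newspace V k q) Bnew) (x : cuspSpace k q) :
    projection (cuspInner V k hq) (fun φ : Bnew => ⟨φ, (hBnew.mem φ.2).1⟩) x =
      isolator V k hq B x := by
  apply Subtype.ext
  conv_rhs => rw [← hBnew.expansion hq (fun f hf => hf.1)
    (isolator_mem_newspace hcube hB hV hq x), ← Finset.sum_coe_sort]
  rw [projection_apply, AddSubmonoidClass.coe_finsetSum]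
  refine Finset.sum_congr rfl fun φ _ => ?_
  rw [Submodule.coe_smul]
  congr 1
  -- The coefficients agree: ⟨φ, x⟩ = ⟨Iφ, x⟩ = ⟨φ, Ix⟩ for the isolator I and new φ.
  have h := isolator_of_mem_newspace hcube hB hV hq (x := ⟨φ, (hBnew.mem φ.2).1⟩) (hBnew.mem φ.2)
  conv_lhs => rw [← h]
  rw [isolator_symm]
  rfl

end Isolation

end NewformIsolation

end

/-! ### The isolation formula. -/

theorem mainTheorem6 (k : ℕ) (hk : 0 < k) (V : ℝ) (hV : 0 < V)
    (q : ℕ) (hq : 0 < q) (hcube : ∀ p : ℕ, p.Prime → p ∣ q → p ^ 3 ∣ q)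
    (n : ℕ) (hn : 0 < n) (hnq : Nat.Coprime n q)
    (Ψ : ℍ → ℂ) (hΨmeas : AEMeasurable Ψ (volume : Measure ℍ))
    (hΨinv : ∀ γ ∈ CongruenceSubgroup.Gamma0 q, ∀ z : ℍ, Ψ (γ • z) = Ψ z)
    (hΨgrowth : NewformIsolation.ModerateGrowth Ψ)
    (Bnew : Finset (ℍ → ℂ))
    (hBnew : NewformIsolation.IsOrthonormalBasis V k q (NewformIsolation.newspace V k q) Bnew)
    (B : ℕ → Finset (ℍ → ℂ))
    (hB : ∀ ℓ : ℕ, ℓ ∣ q → NewformIsolation.IsOrthonormalBasis V k ℓ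
      (NewformIsolation.cuspSpace k ℓ : Set (ℍ → ℂ)) (B ℓ)) :
    -- all the integrals that occur converge absolutely
    (∀ φ ∈ Bnew, Integrable (petersson (k : ℤ) φ (Ψ * NewformIsolation.hecke k n φ))
      (NewformIsolation.levelMeasure V q)) ∧
    (∀ d ∈ q.divisors, ∀ e ∈ q.divisors,
      ArithmeticFunction.moebius d * ArithmeticFunction.moebius e ≠ 0 →
      ∀ φ ∈ B (q / (d * e)),
        Integrable (petersson (k : ℤ) (NewformIsolation.raise k d φ)
          (Ψ * NewformIsolation.hecke k n (NewformIsolation.raise k d φ)))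
          (NewformIsolation.levelMeasure V q)) ∧
    ∑ φ ∈ Bnew, NewformIsolation.peterssonInner V k q φ (Ψ * NewformIsolation.hecke k n φ) =
      ∑ d ∈ q.divisors, ∑ e ∈ q.divisors,
        (ArithmeticFunction.moebius d : ℂ) * (ArithmeticFunction.moebius e : ℂ) *
          ∑ φ ∈ B (q / (d * e)),
            NewformIsolation.peterssonInner V k q (NewformIsolation.raise k d φ)
              (Ψ * NewformIsolation.hecke k n (NewformIsolation.raise k d φ)) := by
  open NewformIsolation in
  have hq0 : q ≠ 0 := hq.ne'
  have hint : ∀ f g : ℍ → ℂ, f ∈ cuspSpace k q → g ∈ cuspSpace k q →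
      Integrable (petersson (k : ℤ) f (Ψ * hecke k n g)) (levelMeasure V q) := fun f g hf hg =>
    integrable_petersson_mul V hq0 hf ((isModeratelyBounded_of_mem_cuspSpace hq0 hg).hecke n)
      hΨmeas hΨgrowth
  have hlevel : ∀ d ∈ q.divisors, ∀ e ∈ q.divisors,
      ArithmeticFunction.moebius d * ArithmeticFunction.moebius e ≠ 0 →
      d ≠ 0 ∧ d * (q / (d * e)) ∣ q ∧ q / (d * e) ∣ q := by
    intro d hd e he hne
    have hds := ArithmeticFunction.moebius_ne_zero_iff_squarefree.1 (left_ne_zero_of_mul hne)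
    have hes := ArithmeticFunction.moebius_ne_zero_iff_squarefree.1 (right_ne_zero_of_mul hne)
    have hde := mul_dvd_of_squarefree hcube hq0 hds hes (Nat.dvd_of_mem_divisors hd)
      (Nat.dvd_of_mem_divisors he)
    refine ⟨hds.ne_zero, ⟨e, ?_⟩, Nat.div_dvd_of_dvd hde⟩
    rw [mul_right_comm, Nat.mul_div_cancel' hde]
  refine ⟨fun φ hφ => hint φ φ (hBnew.mem hφ).1 (hBnew.mem hφ).1, fun d hd e he hne φ hφ => ?_, ?_⟩
  · obtain ⟨hd0, h1, h2⟩ := hlevel d hd e he hne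
    have := raise_mem_cuspSpace hd0 h1 ((hB _ h2).mem hφ)
    exact hint _ _ this this
  let L : cuspSpace k q →ₗ[ℂ] (ℍ → ℂ) :=
    { toFun := fun f => Ψ * hecke k n f
      map_add' := fun f g => by rw [Submodule.coe_add, hecke_add, mul_add]
      map_smul' := fun c f => by
        rw [Submodule.coe_smul, hecke_smul, mul_smul_comm, RingHom.id_apply] }
  let S := innerForm V k q L fun f g => hint f g f.2 g.2
  have hS : ∀ f : cuspSpace k q, S f f = peterssonInner V k q f (Ψ * hecke k n f) := fun _ => rfl
  have hconj := cuspInner_conj (V := V) (k := k) hq0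
  -- The basis of A(q) itself serves as the reference family in which all diagonal sums are
  -- expanded.
  have hv : ∀ x, projection (cuspInner V k hq0) (raisedFamily k q 1 (B q)) x = x := fun x =>
    projection_raisedFamily_of_isCuspOn hV hq0 one_ne_zero (by simp) (hB q dvd_rfl)
      (by rw [levelGroup_one]; exact x.2)
  have hnew := sum_diagonal_eq hconj S hv (fun φ : Bnew => ⟨φ, (hBnew.mem φ.2).1⟩)
  simp only [projection_newspace_eq hcube hB hV hq0 hBnew, isolator_apply, map_sum, map_smul,
    hS] at hnew
  rw [← Finset.sum_coe_sort, hnew, Finset.sum_comm]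
  refine Finset.sum_congr rfl fun d hd => ?_
  simp only [smul_eq_mul, Finset.mul_sum]
  rw [Finset.sum_comm]
  refine Finset.sum_congr rfl fun e he => ?_
  -- When the Möbius product vanishes, de need not divide q, and q/(de) may be a meaningless
  -- truncated quotient; the coefficient 0 removes the term.
  by_cases hne : ArithmeticFunction.moebius d * ArithmeticFunction.moebius e = 0
  · have hne' : (ArithmeticFunction.moebius d : ℂ) * (ArithmeticFunction.moebius e : ℂ) = 0 := by
      exact_mod_cast hne
    simp only [← mul_assoc, hne', zero_mul, Finset.sum_const_zero]
  · obtain ⟨hd0, h1, h2⟩ := hlevel d hd e he hne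
    simp only [← mul_assoc, ← Finset.mul_sum]
    rw [← sum_diagonal_eq hconj S hv, ← Finset.sum_coe_sort (B (q / (d * e)))]
    simp only [hS, coe_raisedFamily hd0 h1 (hB _ h2)]
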